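/- Let $V$ be a real vector space of finite dimension $r$ with a Lebesgue measure $dh$, and let $\Delta\subset V\setminus\{0\}$ be a finite set that spans $V$ and satisfies $\Delta=-\Delta$. A wall is a hyperplane of $V$ generated by $r-1$ linearly independent elements of $\Delta$. Let $V_{reg}$ be the complement of the union of the walls in $V$, and let $V^*_{reg}=\{y\in V^*:\langle\alpha,y\rangle\neq 0 \text{ for all }\alpha\in\Delta\}$. Chambers of $V$ (resp. $V^*$) are the connected components of $V_{reg}$ (resp. $V^*_{reg}$). For $\delta\subset V^*$ put $\delta^\vee=\{h\in V:\langle y,h\rangle\ge 0 \text{ for all } y\in\delta\}$. Let $R_\Delta=\Delta^{-1}S(V)$ be the ring of rational functions on $V^*$ with poles contained in the hyperplanes $\alpha=0$, $\alpha\in\Delta$, on which the algebra $S(V^*)$ acts by differential operators with constant coefficients. Let $G_\Delta\subset R_\Delta$ be the span of the functions $1/\prod_{\alpha\in\kappa}\alpha^{n_\alpha}$ with $\kappa\subset\Delta$ generating $V$ and all $n_\alpha\geq 1$, and $NG_\Delta\subset R_\Delta$ the span of the functions $\psi/\prod_{\alpha\in\kappa}\alpha^{n_\alpha}$ with $\psi\in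 S(V)$, $\kappa\subset\Delta$ not generating $V$ and all $n_\alpha\ge 0$. For a finite set $\kappa\subset V$ let $C(\kappa)$ be the closed convex cone generated by $\kappa$; write $[A]$ for the characteristic function of a set $A$, $C^0$ for the relative interior of a cone $C$, and $|\det\sigma|$ for the volume of the parallelepiped on a basis $\sigma$. Let $\gamma\subset V$ and $\delta\subset V^*$ be chambers and let $p\in\gamma$. (i) For every $\phi\in G_\Delta$ there is a unique function $F_\delta(\phi)$ on $V_{reg}$ in the span of the functions $P\,[C(\sigma)]$ ($P$ a polynomial function on $V$, $\sigma\subset\Delta$ a basis of $V$ with $C(\sigma)\subset\delta^\vee$) such that $\int_V e^{-\langle y,h\rangle}F_\delta(\phi)(h)\,dh=\phi(y)$ for all $y\in\delta$. (ii) For a basis $\sigma\subset\Delta$ of $V$ let $C(\sigma)'_\gamma$ be the set of $h\in C(\sigma)$ such that the segment $[h,q]$ meets $C(\sigma)^0$ for some (equivalently, every) $q\in\gamma$. Let $\mathcal{PP}_\Delta$ be the span of the functions $P\,[C(\kappa)]$ on $V$ ($P$ a polynomial function on $V$, $\kappa\subset\Delta$). There is a unique linear map $F_{\gamma,\delta}:R_\Delta\to\mathcal{PP}_\Delta$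 which commutes with the actions of $S(V^*)$ (by differential operators on $R_\Delta$, by multiplication on $\mathcal{PP}_\Delta$) up to the automorphism $P(h)\mapsto P(-h)$, which satisfies $F_{\gamma,\delta}\bigl(|\det\sigma|/\prod_{\alpha\in\sigma}\alpha\bigr)=[C(\sigma)'_\gamma]$ for all bases $\sigma\subset\Delta$ of $V$ with $C(\sigma)\subset\delta^\vee$, and which vanishes on $NG_\Delta$ (the stratified Fourier transform). (iii) For every $\phi\in G_\Delta$ and $h\in V$, the point $h+\epsilon p$ is in $V_{reg}$ for all sufficiently small $\epsilon>0$, and $$F_{\gamma,\delta}(\phi)(h)=\lim_{\epsilon\to 0,\ \epsilon>0}F_\delta(\phi)(h+\epsilon p).$$ In particular, $F_{\gamma,\delta}(\phi)$ is an extension of $F_\delta(\phi)$ to the whole of $V$, and if $F_\delta(\phi)$ has a continuous extension to $V$, then $F_{\gamma,\delta}(\phi)$ is this extension. -/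

import Mathlib

open MeasureTheory Filter Topology

noncomputable section

namespace StratifiedFourier

variable {V : Type*} [NormedAddCommGroup V] [NormedSpace ℝ V]

/-! ### The two arrangements and their chambers -/

/-- `W` is a wall: a hyperplane generated by `r - 1` linearly independent elements of `Δ`,
where `r = dim V`. -/
def IsWall (Δ : Finset V) (W : Submodule ℝ V) : Prop :=
  ∃ s : Finset V, s ⊆ Δ ∧ LinearIndependent ℝ (fun a : s => (a : V)) ∧
    s.card + 1 = Module.finrank ℝ V ∧ W = Submodule.span ℝ (s : Set V)

/-- The regular elements of `V`: those that lie in no wall. -/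
def reg (Δ : Finset V) : Set V := {h | ∀ W : Submodule ℝ V, IsWall Δ W → h ∉ W}

/-- The regular elements of `V*`: those that lie in no hyperplane `α = 0`, `α ∈ Δ`. -/
def dualReg (Δ : Finset V) : Set (StrongDual ℝ V) := {y | ∀ α ∈ Δ, y α ≠ 0}

/-- A chamber of `V`: a connected component of the set of regular elements. -/
def IsChamber (Δ : Finset V) (γ : Set V) : Prop :=
  ∃ x ∈ reg Δ, γ = connectedComponentIn (reg Δ) x

/-- A chamber of `V*`: a connected component of the set of regular elements. -/
def IsDualChamber (Δ : Finset V) (δ : Set (StrongDual ℝ V)) : Prop :=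
  ∃ y ∈ dualReg Δ, δ = connectedComponentIn (dualReg Δ) y

/-- The closed dual cone `δ^∨ ⊆ V` of a subset `δ` of `V*`. -/
def dualCone (δ : Set (StrongDual ℝ V)) : Set V := {h | ∀ y ∈ δ, 0 ≤ y h}

/-! ### Bases and cones -/

/-- `κ ⊆ Δ` generates `V`. -/
def IsGenerating (Δ κ : Finset V) : Prop :=
  κ ⊆ Δ ∧ Submodule.span ℝ (κ : Set V) = ⊤

/-- `σ ⊆ Δ` is a basis of `V`. -/
def IsBasis (Δ σ : Finset V) : Prop :=
  IsGenerating Δ σ ∧ LinearIndependent ℝ (fun a : σ => (a : V))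

/-- `C(κ)`, the closed convex cone generated by `κ`. -/
def cone (κ : Finset V) : Set V :=
  {h | ∃ c : V → ℝ, (∀ a ∈ κ, 0 ≤ c a) ∧ h = ∑ a ∈ κ, c a • a}

/-- `C(σ)'_γ`: the points `h` of `C(σ)` such that the segment `[h, p]` meets the relative interior
of `C(σ)`, where `p ∈ γ` (the choice of `p` in the chamber `γ` does not matter). -/
def shiftedCone (γ : Set V) (σ : Finset V) : Set V :=
  {h | h ∈ cone σ ∧ ∃ p ∈ γ, (segment ℝ h p ∩ intrinsicInterior ℝ (cone σ)).Nonempty}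

/-- `|det σ|`, the volume of the parallelepiped constructed on `σ`. -/
def vol [MeasurableSpace V] (μ : Measure V) (σ : Finset V) : ℝ :=
  μ.real (parallelepiped (fun a : σ => (a : V)))

/-! ### Polynomial functions -/

/-- `S(V*)`, as the algebra of polynomial functions on `V`. -/
def polyFun (V : Type*) [NormedAddCommGroup V] [NormedSpace ℝ V] : Subalgebra ℝ (V → ℝ) :=
  Algebra.adjoin ℝ (Set.range fun (y : StrongDual ℝ V) (h : V) => y h)

/-- `S(V)`, as the algebra of polynomial functions on `V*`. -/
def dualPolyFun (V : Type*) [NormedAddCommGroup V] [NormedSpace ℝ V] :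
    Subalgebra ℝ (StrongDual ℝ V → ℝ) :=
  Algebra.adjoin ℝ (Set.range fun (v : V) (y : StrongDual ℝ V) => y v)

/-! ### The ring `R_Δ` and its subspaces `G_Δ`, `NG_Δ` -/

/-- `R_Δ = Δ⁻¹ S(V)`, as an algebra of functions on the regular elements of `V*`: it is generated
by the linear functions `v ∈ V` and the inverses of the `α ∈ Δ`. -/
def ratRing (Δ : Finset V) : Subalgebra ℝ (dualReg Δ → ℝ) :=
  Algebra.adjoin ℝ
    ((Set.range fun (v : V) (y : dualReg Δ) => y.1 v) ∪
      {φ | ∃ α ∈ Δ, φ = fun y : dualReg Δ => (y.1 α)⁻¹})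

/-- `1 / ∏_{α ∈ κ} α ^ (n α)`. -/
def invProd (Δ κ : Finset V) (hκ : κ ⊆ Δ) (n : V → ℕ) : ratRing Δ :=
  ⟨fun y => 1 / ∏ α ∈ κ, y.1 α ^ n α, by
    have h : (fun y : dualReg Δ => 1 / ∏ α ∈ κ, y.1 α ^ n α) =
        ∏ α ∈ κ, (fun y : dualReg Δ => (y.1 α)⁻¹) ^ n α := by
      funext y
      simp [Finset.prod_apply]
    rw [h]
    have hm : ∀ α ∈ κ, (fun y : dualReg Δ => (y.1 α)⁻¹) ∈ ratRing Δ := fun α hα =>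
      Algebra.subset_adjoin (Or.inr ⟨α, hκ hα, rfl⟩)
    exact prod_mem fun α hα => pow_mem (hm α hα) (n α)⟩

/-- `G_Δ`, spanned by the `1 / ∏_{α ∈ κ} α ^ (n α)` with `κ` generating and all `n α` positive. -/
def G (Δ : Finset V) : Submodule ℝ (ratRing Δ) :=
  Submodule.span ℝ {φ | ∃ (κ : Finset V) (hκ : IsGenerating Δ κ) (n : V → ℕ),
    (∀ α ∈ κ, 0 < n α) ∧ φ = invProd Δ κ hκ.1 n}

/-- `NG_Δ`, spanned by the `ψ / ∏_{α ∈ κ} α ^ (n α)` with `ψ ∈ S(V)`, `κ ⊆ Δ` not generating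
and all `n α` nonnegative. -/
def NG (Δ : Finset V) : Submodule ℝ (ratRing Δ) :=
  Submodule.span ℝ {φ | ∃ (κ : Finset V) (_ : κ ⊆ Δ) (_ : ¬ IsGenerating Δ κ) (n : V → ℕ)
    (ψ : StrongDual ℝ V → ℝ) (_ : ψ ∈ dualPolyFun V),
    ∀ y : dualReg Δ, φ.1 y = ψ y.1 / ∏ α ∈ κ, y.1 α ^ n α}

/-! ### The action of `V* ⊆ S(V*)` on `R_Δ` by directional derivatives -/

/-- Extension by zero of a function defined on a subset. -/
def extendZero {E : Type*} {s : Set E} (f : s → ℝ) : E → ℝ :=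
  Function.extend Subtype.val f 0

theorem extendZero_apply {E : Type*} {s : Set E} (f : s → ℝ) (x : s) :
    extendZero f x.1 = f x :=
  Subtype.val_injective.extend_apply f 0 x

theorem eventually_mem_dualReg (Δ : Finset V) (y : dualReg Δ) (w : StrongDual ℝ V) :
    ∀ᶠ t in 𝓝 (0 : ℝ), y.1 + t • w ∈ dualReg Δ := by
  have h : ∀ α ∈ Δ, ∀ᶠ t in 𝓝 (0 : ℝ), (y.1 + t • w) α ≠ 0 := by
    intro α hα
    have hc : Continuous fun t : ℝ => (y.1 + t • w) α := by
      simp only [add_apply, smul_apply]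
      fun_prop
    refine hc.continuousAt.eventually_ne ?_
    simpa using y.2 α hα
  exact (Filter.eventually_all_finset Δ).2 h

theorem hasLineDerivAt_congr_dualReg {Δ : Finset V} {φ : dualReg Δ → ℝ}
    {g : StrongDual ℝ V → ℝ} (hg : ∀ y : dualReg Δ, φ y = g y.1) {y : dualReg Δ}
    {w : StrongDual ℝ V} {c : ℝ} (h : HasLineDerivAt ℝ g c y.1 w) :
    HasLineDerivAt ℝ (extendZero φ) c y.1 w := by
  refine HasDerivAt.congr_of_eventuallyEq h ?_
  filter_upwards [eventually_mem_dualReg Δ y w] with t ht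
  rw [extendZero_apply φ ⟨_, ht⟩, hg]

theorem extendZero_add {E : Type*} {s : Set E} (f g : s → ℝ) :
    extendZero (f + g) = extendZero f + extendZero g := by
  funext x
  by_cases hx : x ∈ s
  · simp only [Pi.add_apply]
    rw [extendZero_apply _ ⟨x, hx⟩, extendZero_apply _ ⟨x, hx⟩, extendZero_apply _ ⟨x, hx⟩]
    rfl
  · simp [extendZero, Function.extend_apply', hx]

theorem extendZero_mul {E : Type*} {s : Set E} (f g : s → ℝ) :
    extendZero (f * g) = extendZero f * extendZero g := by
  funext x
  by_cases hx : x ∈ s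
  · simp only [Pi.mul_apply]
    rw [extendZero_apply _ ⟨x, hx⟩, extendZero_apply _ ⟨x, hx⟩, extendZero_apply _ ⟨x, hx⟩]
    rfl
  · simp [extendZero, Function.extend_apply', hx]

/-- The functions in `R_Δ` are differentiable along every direction, with derivative in `R_Δ`. -/
theorem exists_lineDeriv (Δ : Finset V) (w : StrongDual ℝ V) (φ : dualReg Δ → ℝ)
    (hφ : φ ∈ ratRing Δ) :
    ∃ ψ ∈ ratRing Δ, ∀ y : dualReg Δ, HasLineDerivAt ℝ (extendZero φ) (ψ y) y.1 w := by
  have hlin : ∀ (v : V) (y : StrongDual ℝ V),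
      HasLineDerivAt ℝ (fun z : StrongDual ℝ V => z v) (w v) y w := by
    intro v y
    have h := ((hasDerivAt_id (0 : ℝ)).mul_const (w v)).const_add (y v)
    simpa [HasLineDerivAt] using h
  induction hφ using Algebra.adjoin_induction with
  | mem φ h =>
    rcases h with ⟨v, rfl⟩ | ⟨α, hα, rfl⟩
    · exact ⟨algebraMap ℝ _ (w v), Subalgebra.algebraMap_mem _ _, fun y =>
        hasLineDerivAt_congr_dualReg (g := fun z => z v) (fun _ => rfl) (hlin v y.1)⟩
    · have hm : (fun y : dualReg Δ => (y.1 α)⁻¹) ∈ ratRing Δ :=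
        Algebra.subset_adjoin (Or.inr ⟨α, hα, rfl⟩)
      refine ⟨(-(w α)) • ((fun y : dualReg Δ => (y.1 α)⁻¹) ^ 2),
        Subalgebra.smul_mem _ (pow_mem hm 2) _, fun y => ?_⟩
      refine hasLineDerivAt_congr_dualReg (g := fun z => (z α)⁻¹) (fun _ => rfl) ?_
      have h := HasDerivAt.inv (hlin α y.1) (by simpa using y.2 α hα)
      refine HasDerivAt.congr_deriv h ?_
      simp [div_eq_mul_inv]
  | algebraMap r =>
    refine ⟨0, zero_mem _, fun y => ?_⟩
    exact hasLineDerivAt_congr_dualReg (g := fun _ => r) (fun _ => rfl)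
      (hasDerivAt_const (0 : ℝ) r)
  | add f g _ _ hf hg =>
    obtain ⟨f', hf', hf⟩ := hf
    obtain ⟨g', hg', hg⟩ := hg
    refine ⟨f' + g', add_mem hf' hg', fun y => ?_⟩
    rw [extendZero_add]
    exact HasDerivAt.add (hf y) (hg y)
  | mul f g hfm hgm hf hg =>
    obtain ⟨f', hf', hf⟩ := hf
    obtain ⟨g', hg', hg⟩ := hg
    refine ⟨f' * g + f * g', add_mem (mul_mem hf' hgm) (mul_mem hfm hg'), fun y => ?_⟩
    rw [extendZero_mul]
    have h := HasDerivAt.mul (hf y) (hg y)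
    refine HasDerivAt.congr_deriv h ?_
    simp [extendZero_apply]

/-- `∂(w) φ`, the derivative of `φ ∈ R_Δ` in the direction `w ∈ V*`. These operators generate the
action of `S(V*)` on `R_Δ` by differential operators with constant coefficients. -/
def dirDeriv (Δ : Finset V) (w : StrongDual ℝ V) (φ : ratRing Δ) : ratRing Δ :=
  ⟨fun y => lineDeriv ℝ (extendZero φ.1) y.1 w, by
    obtain ⟨ψ, hψ, h⟩ := exists_lineDeriv Δ w φ.1 φ.2
    have e : (fun y : dualReg Δ => lineDeriv ℝ (extendZero φ.1) y.1 w) = ψ := by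
      funext y
      exact (h y).lineDeriv
    rw [e]
    exact hψ⟩

/-! ### The inverse Laplace transform `F_δ` -/

/-- `P_Δ(δ)`, spanned by the functions `P [C(σ)]` on the regular elements of `V`, where `P` is
polynomial and `σ ⊆ Δ` is a basis with `C(σ) ⊆ δ^∨`. -/
def locPoly (Δ : Finset V) (δ : Set (StrongDual ℝ V)) : Submodule ℝ (reg Δ → ℝ) :=
  Submodule.span ℝ {f | ∃ P ∈ polyFun V, ∃ σ : Finset V, IsBasis Δ σ ∧ cone σ ⊆ dualCone δ ∧
    f = fun h : reg Δ => P h.1 * (cone σ).indicator 1 h.1}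

/-- The Laplace transform `∫ e^{-⟨y,h⟩} f(h) dh` of a function on the regular elements of `V`
(whose complement is negligible). -/
def laplace [MeasurableSpace V] (μ : Measure V) (Δ : Finset V) (f : reg Δ → ℝ)
    (y : StrongDual ℝ V) : ℝ :=
  ∫ h : reg Δ, Real.exp (-(y h.1)) * f h ∂(μ.comap Subtype.val)

/-- `f ∈ P_Δ(δ)` and the Laplace transform of `f` is `φ`. -/
def IsInverseLaplace [MeasurableSpace V] (μ : Measure V) (Δ : Finset V)
    (δ : Set (StrongDual ℝ V)) (φ : ratRing Δ) (f : reg Δ → ℝ) : Prop :=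
  f ∈ locPoly Δ δ ∧ ∀ y : dualReg Δ, y.1 ∈ δ → laplace μ Δ f y.1 = φ.1 y

/-- `F_δ(φ)`, the inverse Laplace transform of `φ ∈ G_Δ`: the unique element of `P_Δ(δ)` with
Laplace transform `φ`. -/
def inverseLaplace [MeasurableSpace V] (μ : Measure V) (Δ : Finset V)
    (δ : Set (StrongDual ℝ V)) (φ : ratRing Δ) : reg Δ → ℝ :=
  Classical.epsilon (IsInverseLaplace μ Δ δ φ)

/-! ### The stratified Fourier transform `F_{γ,δ}` -/

/-- `PP_Δ`, spanned by the functions `P [C]` on `V`, where `P` is polynomial and `C` is a closed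
polyhedral cone generated by a subset of `Δ`. -/
def piecePoly (Δ : Finset V) : Submodule ℝ (V → ℝ) :=
  Submodule.span ℝ {f | ∃ P ∈ polyFun V, ∃ κ : Finset V, κ ⊆ Δ ∧
    f = fun h => P h * (cone κ).indicator 1 h}

/-- The conditions that define the stratified Fourier transform. -/
structure IsStratifiedFourier [MeasurableSpace V] (μ : Measure V) (Δ : Finset V) (γ : Set V)
    (δ : Set (StrongDual ℝ V)) (F : ratRing Δ →ₗ[ℝ] piecePoly Δ) : Prop where
  /-- `F` commutes with the action of `S(V*)` up to the automorphism `P(h) ↦ P(-h)` (it is enough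
  to say so for the generators `w ∈ V*`). -/
  map_dirDeriv : ∀ (w : StrongDual ℝ V) (φ : ratRing Δ) (h : V),
    (F (dirDeriv Δ w φ)).1 h = -(w h) * (F φ).1 h
  /-- `F(|det σ| / ∏_{α ∈ σ} α) = [C(σ)'_γ]` for all bases `σ` with `C(σ) ⊆ δ^∨`. -/
  map_basis : ∀ (σ : Finset V) (hσ : IsBasis Δ σ), cone σ ⊆ dualCone δ →
    (F (vol μ σ • invProd Δ σ hσ.1.1 fun _ => 1)).1 = (shiftedCone γ σ).indicator 1
  /-- `F(NG_Δ) = 0`. -/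
  map_NG : ∀ φ ∈ NG Δ, F φ = 0

/-- `F_{γ,δ}`, the unique map with these properties. -/
def stratifiedFourier [MeasurableSpace V] (μ : Measure V) (Δ : Finset V) (γ : Set V)
    (δ : Set (StrongDual ℝ V)) : ratRing Δ →ₗ[ℝ] piecePoly Δ :=
  Classical.epsilon (IsStratifiedFourier μ Δ γ δ)

end StratifiedFourier

end

/-! In the coordinates of a basis σ ⊆ Δ the cone C(σ) is an orthant, and the Laplace integral splits
into one-variable Gamma integrals. So 1/∏ a^(m_a+1) is the transform of an explicit polynomial times
[C(σ)] at every y positive on σ (`IsBasis.integral_exp_mul_expPoly`). Fix y ∈ δ. Since Δ = -Δ, the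
signs in a denominator can be changed to make every factor positive at y, and partial fractions then
reduce all of G_Δ to such basis fractions (`G_eq_posFracSpan`). This gives the existence of F_δ.
Uniqueness is injectivity of the Laplace transform: for F supported in δ^∨, a vanishing transform on
δ makes a weight e^{-y₀}F orthogonal to a point-separating algebra of bounded functions, so F = 0
almost everywhere. The functions concerned are continuous on V_reg, hence vanish there.

The limit formula serves to construct F_{γ,δ}. Every φ is φ₁ + φ₂ with φ₁ ∈ G_Δ and φ₂ ∈ NG_Δ
(`G_sup_NG`), and its value is the limit of F_δ(φ₁) along h + εp. The limit exists because, for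
small ε, h + εp ∈ C(σ) exactly when h ∈ C(σ)'_γ. The value does not depend on the decomposition: an
element of NG_Δ is killed by a product of derivatives along nonzero directions, while F_δ turns ∂(w)
into multiplication by -w, which is nonzero almost everywhere. Hence F_δ vanishes on G_Δ ∩ NG_Δ
(`IsInverseLaplace.eq_zero_of_mem_NG`).

Uniqueness of this value (`IsStratifiedValue.unique`) yields linearity and the three defining
conditions. Conversely, these conditions determine the map: it is zero on NG_Δ, and derivatives
along the dual basis of σ produce all basis fractions from 1/∏ a
(`IsStratifiedFourier.map_frac_eq`). -/

noncomputable section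

/-! ### Geometry of cones, walls and chambers. -/

namespace StratifiedFourier

variable {V : Type*} [NormedAddCommGroup V] [NormedSpace ℝ V]

/-! ### Coordinates with respect to a basis contained in `Δ` -/

/-- A basis `σ ⊆ Δ` as a basis indexed by its elements. -/
def IsBasis.basis {Δ σ : Finset V} (hσ : IsBasis Δ σ) : Module.Basis σ ℝ V :=
  Module.Basis.mk hσ.2 (by
    have h := hσ.1.2
    rw [← h]
    refine Submodule.span_mono ?_
    intro a ha
    exact ⟨⟨a, ha⟩, rfl⟩)

theorem IsBasis.basis_apply {Δ σ : Finset V} (hσ : IsBasis Δ σ) (a : σ) : hσ.basis a = a := by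
  simp [IsBasis.basis]

theorem IsBasis.coe_basis {Δ σ : Finset V} (hσ : IsBasis Δ σ) :
    ⇑hσ.basis = fun a : σ => (a : V) :=
  funext hσ.basis_apply

theorem IsBasis.card_eq {Δ σ : Finset V} (hσ : IsBasis Δ σ) : σ.card = Module.finrank ℝ V := by
  rw [Module.finrank_eq_card_basis hσ.basis]
  simp

section Coord

variable [FiniteDimensional ℝ V] {Δ σ : Finset V}

/-- The coordinates with respect to a basis `σ ⊆ Δ`. -/
def IsBasis.coord (hσ : IsBasis Δ σ) (a : σ) : StrongDual ℝ V :=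
  LinearMap.toContinuousLinearMap (hσ.basis.coord a)

theorem IsBasis.coord_apply (hσ : IsBasis Δ σ) (a : σ)
    (h : V) : hσ.coord a h = hσ.basis.repr h a := rfl

theorem IsBasis.sum_coord (hσ : IsBasis Δ σ) (h : V) : ∑ a : σ, hσ.coord a h • (a : V) = h := by
  conv_rhs => rw [← hσ.basis.sum_repr h]
  simp [IsBasis.coord_apply, IsBasis.basis_apply]

theorem IsBasis.coord_sum (hσ : IsBasis Δ σ) (c : σ → ℝ) (a : σ) : hσ.coord a (∑ b : σ, c b •
    (b : V)) = c a := by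
  have h := hσ.basis.repr_sum_self c
  simp only [IsBasis.basis_apply] at h
  rw [IsBasis.coord_apply, h]

theorem IsBasis.coord_self (hσ : IsBasis Δ σ) [DecidableEq V] (a b : σ) :
    hσ.coord a (b : V) = if a = b then 1 else 0 := by
  rw [← hσ.basis_apply b, IsBasis.coord_apply, Module.Basis.repr_self, Finsupp.single_apply]
  simp [eq_comm]

theorem IsBasis.dual_apply (hσ : IsBasis Δ σ) (y : StrongDual ℝ V) (h : V) :
    y h = ∑ a : σ, y (a : V) * hσ.coord a h := by
  conv_lhs => rw [← hσ.sum_coord h]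
  simp [mul_comm]

/-- Points of the cone generated by `κ ⊆ σ`: nonnegative coordinates, vanishing outside `κ`. -/
theorem IsBasis.mem_cone_subset (hσ : IsBasis Δ σ) {κ : Finset V} (hκ : κ ⊆ σ) (h : V) :
    h ∈ cone κ ↔ ∀ a : σ, 0 ≤ hσ.coord a h ∧ ((a : V) ∉ κ → hσ.coord a h = 0) := by
  classical
  constructor
  · rintro ⟨c, hc, rfl⟩ a
    have e : ∑ b ∈ κ, c b • b = ∑ b : σ, (if (b : V) ∈ κ then c b else 0) • (b : V) := by
      rw [Finset.sum_coe_sort σ (fun b => (if b ∈ κ then c b else 0) • b)]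
      simp only [ite_smul, zero_smul]
      rw [← Finset.sum_filter]
      congr 1
      ext b
      simp only [Finset.mem_filter]
      exact ⟨fun hb => ⟨hκ hb, hb⟩, fun hb => hb.2⟩
    rw [e, hσ.coord_sum]
    split_ifs with ha
    · exact ⟨hc a ha, fun h => absurd ha h⟩
    · simp
  · intro hh
    refine ⟨fun v => if hv : v ∈ σ then hσ.coord ⟨v, hv⟩ h else 0, ?_, ?_⟩
    · intro a ha
      simpa [hκ ha] using (hh ⟨a, hκ ha⟩).1
    · conv_lhs => rw [← hσ.sum_coord h]
      rw [Finset.sum_subset hκ]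
      · rw [← Finset.sum_coe_sort σ]
        simp
      · intro a ha hna
        have := (hh ⟨a, ha⟩).2 hna
        simp [ha, this]

theorem IsBasis.mem_cone (hσ : IsBasis Δ σ) (h : V) : h ∈ cone σ ↔ ∀ a : σ, 0 ≤ hσ.coord a h := by
  rw [hσ.mem_cone_subset (Finset.Subset.refl σ)]
  exact forall_congr' fun a => ⟨fun h => h.1, fun h => ⟨h, fun hn => absurd a.2 hn⟩⟩

theorem IsBasis.mem_cone_iff_indicator (hσ : IsBasis Δ σ) (h : V) :
    (cone σ).indicator (1 : V → ℝ) h = ∏ a : σ, (Set.Ici (0 : ℝ)).indicator 1 (hσ.coord a h) := by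
  classical
  by_cases hh : h ∈ cone σ
  · rw [Set.indicator_of_mem hh, Finset.prod_eq_one]
    · rfl
    · intro a _
      rw [Set.indicator_of_mem]
      · rfl
      · exact (hσ.mem_cone h).1 hh a
  · rw [Set.indicator_of_notMem hh]
    rw [hσ.mem_cone] at hh
    push Not at hh
    obtain ⟨a, ha⟩ := hh
    rw [Finset.prod_eq_zero (Finset.mem_univ a)]
    exact Set.indicator_of_notMem (by simpa using ha) _

/-! ### Regular elements -/

/-- If the coordinate at a vanishes, h lies in the span of σ without a, which is a wall. -/
theorem IsBasis.coord_ne_zero (hσ : IsBasis Δ σ) {h : V} (hh : h ∈ reg Δ)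
    (a : σ) : hσ.coord a h ≠ 0 := by
  classical
  intro h0
  refine hh (Submodule.span ℝ ((σ.erase a : Finset V) : Set V)) ⟨σ.erase a, ?_, ?_, ?_, rfl⟩ ?_
  · exact (Finset.erase_subset _ _).trans hσ.1.1
  · exact hσ.2.comp (fun b : (σ.erase (a : V) : Finset V) => (⟨b, Finset.mem_of_mem_erase b.2⟩ : σ))
      (fun b c hbc => Subtype.ext (congrArg (fun x : σ => (x : V)) hbc))
  · rw [Finset.card_erase_add_one a.2, hσ.card_eq]
  · rw [← hσ.sum_coord h]
    refine Submodule.sum_mem _ fun b _ => ?_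
    by_cases hb : b = a
    · subst hb
      rw [h0, zero_smul]
      exact zero_mem _
    · refine Submodule.smul_mem _ _ (Submodule.subset_span ?_)
      simp only [Finset.coe_erase, Set.mem_sdiff, Finset.mem_coe, Set.mem_singleton_iff]
      exact ⟨b.2, fun h => hb (Subtype.ext h)⟩

end Coord

theorem IsWall.ne_top {Δ : Finset V} {W : Submodule ℝ V} (hW : IsWall Δ W) : W ≠ ⊤ := by
  classical
  obtain ⟨s, -, -, hs, rfl⟩ := hW
  intro h
  have h1 := finrank_span_finset_le_card (R := ℝ) s
  rw [Set.finrank, h, finrank_top] at h1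
  omega

theorem finite_walls (Δ : Finset V) : {W : Submodule ℝ V | IsWall Δ W}.Finite := by
  classical
  refine (Δ.powerset.finite_toSet.image fun s : Finset V => Submodule.span ℝ (s : Set V)).subset ?_
  rintro W ⟨s, hs, -, -, rfl⟩
  exact ⟨s, by simpa using hs, rfl⟩

theorem compl_reg (Δ : Finset V) :
    (reg Δ)ᶜ = ⋃ W ∈ {W : Submodule ℝ V | IsWall Δ W}, (W : Set V) := by
  ext h
  simp [reg]

theorem isOpen_reg [FiniteDimensional ℝ V] (Δ : Finset V) : IsOpen (reg Δ) := by
  rw [← isClosed_compl_iff, compl_reg]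
  exact (finite_walls Δ).isClosed_biUnion fun W _ => W.closed_of_finiteDimensional

theorem measure_compl_reg [FiniteDimensional ℝ V] [MeasurableSpace V] [BorelSpace V]
    (μ : Measure V) [μ.IsAddHaarMeasure] (Δ : Finset V) : μ (reg Δ)ᶜ = 0 := by
  rw [compl_reg, measure_biUnion_null_iff (finite_walls Δ).countable]
  exact fun W hW => μ.addHaar_submodule W (IsWall.ne_top hW)

/-- Since p lies in no wall, a line of direction p meets each of the finitely many walls at most
once. -/
theorem eventually_add_smul_mem_reg (Δ : Finset V) {p : V} (hp : p ∈ reg Δ) (h : V) :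
    ∀ᶠ ε : ℝ in 𝓝[>] 0, h + ε • p ∈ reg Δ := by
  have key : ∀ W ∈ {W : Submodule ℝ V | IsWall Δ W}, ∀ᶠ ε : ℝ in 𝓝[>] 0, h + ε • p ∉ W := by
    intro W hW
    by_cases hx : ∃ x : ℝ, x ≠ 0 ∧ h + x • p ∈ W
    · obtain ⟨x, hx0, hx⟩ := hx
      have hx' : ∀ᶠ ε : ℝ in 𝓝[>] 0, ε ≠ x :=
        (eventually_ne_nhds hx0.symm).filter_mono nhdsWithin_le_nhds
      filter_upwards [hx'] with ε hε hmem
      refine hp W hW ?_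
      have h2 := W.sub_mem hmem hx
      rw [add_sub_add_left_eq_sub, ← sub_smul] at h2
      exact (W.smul_mem_iff (sub_ne_zero.2 hε)).1 h2
    · push Not at hx
      filter_upwards [self_mem_nhdsWithin] with ε hε
      exact hx ε (ne_of_gt hε)
  have := (eventually_all_finite (finite_walls Δ)).2 key
  filter_upwards [this] with ε hε W hW
  exact hε W hW

/-! ### Chambers -/

/-- Intermediate value theorem. It is applied to linear forms, which therefore keep their sign on a
chamber. -/
theorem mul_pos_of_isPreconnected {X : Type*} [TopologicalSpace X] {s : Set X}
    (hs : IsPreconnected s) {f : X → ℝ} (hf : ContinuousOn f s) (h0 : ∀ x ∈ s, f x ≠ 0)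
    {x y : X} (hx : x ∈ s) (hy : y ∈ s) : 0 < f x * f y := by
  rcases lt_or_gt_of_ne (h0 x hx) with h1 | h1 <;> rcases lt_or_gt_of_ne (h0 y hy) with h2 | h2
  · exact mul_pos_of_neg_of_neg h1 h2
  · obtain ⟨z, hz, hz0⟩ := hs.intermediate_value hx hy hf ⟨h1.le, h2.le⟩
    exact absurd hz0 (h0 z hz)
  · obtain ⟨z, hz, hz0⟩ := hs.intermediate_value hy hx hf ⟨h2.le, h1.le⟩
    exact absurd hz0 (h0 z hz)
  · exact mul_pos h1 h2

theorem IsChamber.subset_reg {Δ : Finset V} {γ : Set V} (hγ : IsChamber Δ γ) : γ ⊆ reg Δ := by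
  obtain ⟨x, -, rfl⟩ := hγ
  exact connectedComponentIn_subset _ _

theorem IsChamber.isPreconnected {Δ : Finset V} {γ : Set V} (hγ : IsChamber Δ γ) :
    IsPreconnected γ := by
  obtain ⟨x, -, rfl⟩ := hγ
  exact isPreconnected_connectedComponentIn

/-- No α ∈ Δ changes sign on δ; conversely the set with prescribed signs is convex, hence connected,
and avoids the hyperplanes α = 0. -/
theorem IsDualChamber.eq_setOf {Δ : Finset V} {δ : Set (StrongDual ℝ V)}
    (hδ : IsDualChamber Δ δ) {y₀ : StrongDual ℝ V} (hy₀ : y₀ ∈ δ) :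
    δ = {y | ∀ α ∈ Δ, 0 < y₀ α * y α} := by
  obtain ⟨x, hx, rfl⟩ := hδ
  have hsub := connectedComponentIn_subset (dualReg Δ) x
  apply Set.Subset.antisymm
  · intro y hy α hα
    refine mul_pos_of_isPreconnected isPreconnected_connectedComponentIn
      (f := fun z : StrongDual ℝ V => z α) ?_ (fun z hz => hsub hz α hα) hy₀ hy
    exact Continuous.continuousOn (by fun_prop)
  · rw [connectedComponentIn_eq hy₀]
    refine IsPreconnected.subset_connectedComponentIn ?_ ?_ ?_
    · refine Convex.isPreconnected ?_
      intro y hy z hz a b ha hb hab α hα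
      have h1 := hy α hα
      have h2 := hz α hα
      have h3 : y₀ α * (a • y + b • z) α = a * (y₀ α * y α) + b * (y₀ α * z α) := by
        simp only [add_apply, smul_apply, smul_eq_mul]; ring
      rw [h3]
      rcases eq_or_lt_of_le ha with rfl | ha'
      · have : b = 1 := by linarith
        subst this; simpa using h2
      · have := mul_pos ha' h1
        have := mul_nonneg hb h2.le
        linarith
    · intro α hα
      exact mul_self_pos.2 (hsub hy₀ α hα)
    · intro y hy α hα h0
      have := hy α hα
      rw [h0, mul_zero] at this
      exact lt_irrefl _ this

theorem IsDualChamber.nonempty {Δ : Finset V} {δ : Set (StrongDual ℝ V)}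
    (hδ : IsDualChamber Δ δ) : δ.Nonempty := by
  obtain ⟨x, hx, rfl⟩ := hδ
  exact ⟨x, mem_connectedComponentIn hx⟩

theorem IsDualChamber.subset_dualReg {Δ : Finset V} {δ : Set (StrongDual ℝ V)}
    (hδ : IsDualChamber Δ δ) : δ ⊆ dualReg Δ := by
  obtain ⟨x, hx, rfl⟩ := hδ
  exact connectedComponentIn_subset _ _

theorem isOpen_dualReg (Δ : Finset V) : IsOpen (dualReg Δ) := by
  have : dualReg Δ = ⋂ α ∈ Δ, {y : StrongDual ℝ V | y α ≠ 0} := by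
    ext y; simp [dualReg]
  rw [this]
  refine isOpen_biInter_finset fun α _ => ?_
  exact isOpen_ne_fun (by fun_prop) continuous_const

theorem IsDualChamber.isOpen {Δ : Finset V} {δ : Set (StrongDual ℝ V)}
    (hδ : IsDualChamber Δ δ) : IsOpen δ := by
  obtain ⟨x, hx, rfl⟩ := hδ
  exact (isOpen_dualReg Δ).connectedComponentIn

theorem IsDualChamber.add_mem {Δ : Finset V} {δ : Set (StrongDual ℝ V)}
    (hδ : IsDualChamber Δ δ) {y z : StrongDual ℝ V} (hy : y ∈ δ) (hz : z ∈ δ) : y + z ∈ δ := by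
  have h := hδ.eq_setOf hy
  have hz' : z ∈ {z | ∀ α ∈ Δ, 0 < y α * z α} := h ▸ hz
  have hy' : y ∈ {z | ∀ α ∈ Δ, 0 < y α * z α} := h ▸ hy
  rw [h]
  intro α hα
  have h1 := hy' α hα
  have h2 := hz' α hα
  rw [add_apply, mul_add]
  exact add_pos h1 h2

theorem subset_cone (κ : Finset V) : (κ : Set V) ⊆ cone κ := by
  classical
  intro a ha
  refine ⟨fun b => if b = a then 1 else 0, fun b _ => by positivity, ?_⟩
  rw [Finset.sum_eq_single a (fun b _ hb => by simp [hb]) (fun h => absurd ha h)]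
  simp

/-- The elements of δ all have the same signs on Δ, so a single y ∈ δ decides. -/
theorem IsDualChamber.cone_subset_iff {Δ : Finset V} {δ : Set (StrongDual ℝ V)}
    (hδ : IsDualChamber Δ δ) {y : StrongDual ℝ V} (hy : y ∈ δ) {κ : Finset V} (hκ : κ ⊆ Δ) :
    cone κ ⊆ dualCone δ ↔ ∀ a ∈ κ, 0 < y a := by
  constructor
  · intro h a ha
    exact lt_of_le_of_ne (h (subset_cone κ ha) y hy) (hδ.subset_dualReg hy a (hκ ha)).symm
  · rintro h x ⟨c, hc, rfl⟩ z hz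
    rw [hδ.eq_setOf hy] at hz
    rw [map_sum]
    refine Finset.sum_nonneg fun a ha => ?_
    rw [map_smul, smul_eq_mul]
    refine mul_nonneg (hc a ha) ?_
    exact (pos_of_mul_pos_right (hz a (hκ ha)) (h a ha).le).le

/-! ### The shifted cone -/

section Shifted

variable [FiniteDimensional ℝ V] {Δ σ : Finset V}

theorem IsBasis.interior_cone (hσ : IsBasis Δ σ) : interior (cone σ) =
    {h | ∀ a : σ, 0 < hσ.coord a h} := by
  let e := hσ.basis.equivFunL
  have h1 : cone σ = e ⁻¹' (Set.univ.pi fun _ : σ => Set.Ici (0 : ℝ)) := by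
    ext h
    rw [hσ.mem_cone]
    simp only [Set.mem_preimage, Set.mem_univ_pi, Set.mem_Ici]
    rfl
  rw [h1]
  have h2 := e.toHomeomorph.preimage_interior (Set.univ.pi fun _ : σ => Set.Ici (0 : ℝ))
  have h3 : ⇑e.toHomeomorph = ⇑e := rfl
  rw [h3] at h2
  rw [← h2, interior_pi_set Set.finite_univ]
  ext h
  simp only [interior_Ici, Set.mem_preimage, Set.mem_univ_pi, Set.mem_Ioi]
  rfl

/-- The cone has nonempty interior, so its affine span is V and the relative interior is the
interior. -/
theorem IsBasis.intrinsicInterior_cone (hσ : IsBasis Δ σ) :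
    intrinsicInterior ℝ (cone σ) = {h | ∀ a : σ, 0 < hσ.coord a h} := by
  rw [← hσ.interior_cone]
  refine Set.Subset.antisymm ?_ interior_subset_intrinsicInterior
  have htop : affineSpan ℝ (cone σ) = ⊤ := by
    refine affineSpan_eq_top_of_nonempty_interior ?_
    refine Set.Nonempty.mono (interior_mono (subset_convexHull ℝ _)) ?_
    rw [hσ.interior_cone]
    refine ⟨∑ b : σ, (1 : ℝ) • (b : V), fun a => ?_⟩
    rw [hσ.coord_sum (fun _ => 1)]
    exact one_pos
  intro x hx
  obtain ⟨y, hy, rfl⟩ := mem_intrinsicInterior.1 hx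
  have hopen : IsOpen ((affineSpan ℝ (cone σ) : AffineSubspace ℝ V) : Set V) := by
    rw [htop]; exact isOpen_univ
  have h1 := hopen.isOpenMap_subtype_val _ (isOpen_interior (s := ((↑) ⁻¹' cone σ :
    Set (affineSpan ℝ (cone σ)))))
  refine interior_maximal ?_ h1 ⟨y, hy, rfl⟩
  rintro _ ⟨z, hz, rfl⟩
  exact interior_subset (s := ((↑) ⁻¹' cone σ : Set (affineSpan ℝ (cone σ)))) hz

theorem IsBasis.coord_mul_pos (hσ : IsBasis Δ σ) {γ : Set V} (hγ : IsChamber Δ γ) {p q : V}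
    (hp : p ∈ γ) (hq : q ∈ γ)
    (a : σ) : 0 < hσ.coord a p * hσ.coord a q :=
  mul_pos_of_isPreconnected hγ.isPreconnected (hσ.coord a).continuous.continuousOn
    (fun _ hx => hσ.coord_ne_zero (hγ.subset_reg hx) a) hp hq

/-- A segment from h ∈ C(σ) to q enters the open orthant exactly when each vanishing coordinate of h
is positive at q. These signs are the same for all q ∈ γ, so they can be read at p. -/
theorem IsBasis.mem_shiftedCone (hσ : IsBasis Δ σ) {γ : Set V} (hγ : IsChamber Δ γ) {p : V}
    (hp : p ∈ γ) (h : V) :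
    h ∈ shiftedCone γ σ ↔
      ∀ a : σ, 0 ≤ hσ.coord a h ∧ (hσ.coord a p < 0 → 0 < hσ.coord a h) := by
  have hp0 := fun a => hσ.coord_ne_zero (hγ.subset_reg hp) a
  constructor
  · rintro ⟨hh, q, hq, z, hz, hzi⟩ a
    rw [hσ.mem_cone] at hh
    refine ⟨hh a, fun hpa => lt_of_le_of_ne (hh a) fun h0 => ?_⟩
    rw [hσ.intrinsicInterior_cone] at hzi
    obtain ⟨s, t, hs, ht, hst, rfl⟩ := hz
    have h1 := hzi a
    have h2 := hσ.coord_mul_pos hγ hp hq a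
    have h3 : hσ.coord a q < 0 := by
      by_contra h4
      push Not at h4
      nlinarith
    rw [map_add, map_smul, map_smul, ← h0, smul_zero, zero_add, smul_eq_mul] at h1
    nlinarith
  · intro hh
    refine ⟨(hσ.mem_cone h).2 fun a => (hh a).1, p, hp, ?_⟩
    rw [hσ.intrinsicInterior_cone]
    have key : ∀ᶠ t : ℝ in 𝓝[>] 0, ∀ a : σ, 0 < hσ.coord a ((1 - t) • h + t • p) := by
      refine eventually_all.2 fun a => ?_
      have hc : Continuous fun t : ℝ => hσ.coord a ((1 - t) • h + t • p) := by fun_prop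
      rcases eq_or_lt_of_le (hh a).1 with h0 | h0
      · have hpa : 0 < hσ.coord a p := by
          refine lt_of_le_of_ne ?_ (hp0 a).symm
          by_contra hneg
          push Not at hneg
          have := (hh a).2 hneg
          linarith
        filter_upwards [self_mem_nhdsWithin] with t ht
        rw [map_add, map_smul, map_smul, ← h0, smul_zero, zero_add, smul_eq_mul]
        exact mul_pos ht hpa
      · have : Tendsto (fun t : ℝ => hσ.coord a ((1 - t) • h + t • p)) (𝓝 0)
            (𝓝 (hσ.coord a h)) := by simpa using hc.tendsto 0
        exact (this.eventually_const_lt h0).filter_mono nhdsWithin_le_nhds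
    have h1 : ∀ᶠ t : ℝ in 𝓝[>] 0, t ≤ 1 :=
      (eventually_le_nhds one_pos).filter_mono nhdsWithin_le_nhds
    obtain ⟨t, ht, ht1, ht0⟩ := (key.and (h1.and self_mem_nhdsWithin)).exists
    exact ⟨_, ⟨1 - t, t, by linarith, le_of_lt ht0, by ring, rfl⟩, ht⟩

/-- Near `0`, the point `h + ε p` lies in `C(σ)` exactly when `h` lies in `C(σ)'_γ`. -/
theorem IsBasis.eventually_mem_cone_iff (hσ : IsBasis Δ σ) {γ : Set V} (hγ : IsChamber Δ γ)
    {p : V} (hp : p ∈ γ)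
    (h : V) : ∀ᶠ ε : ℝ in 𝓝[>] 0, (h + ε • p ∈ cone σ ↔ h ∈ shiftedCone γ σ) := by
  have hp0 := fun a => hσ.coord_ne_zero (hγ.subset_reg hp) a
  have key : ∀ᶠ ε : ℝ in 𝓝[>] 0, ∀ a : σ, (0 ≤ hσ.coord a (h + ε • p) ↔
      (0 ≤ hσ.coord a h ∧ (hσ.coord a p < 0 → 0 < hσ.coord a h))) := by
    refine eventually_all.2 fun a => ?_
    have hc : Continuous fun t : ℝ => hσ.coord a (h + t • p) := by fun_prop
    have ht : Tendsto (fun t : ℝ => hσ.coord a (h + t • p)) (𝓝[>] 0) (𝓝 (hσ.coord a h)) := by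
      have := hc.tendsto 0
      simp only [zero_smul, add_zero] at this
      exact this.mono_left nhdsWithin_le_nhds
    -- A nonzero coordinate of h keeps its sign for small ε; a zero one becomes ε times that of p,
    -- which is nonzero.
    rcases lt_trichotomy (hσ.coord a h) 0 with h0 | h0 | h0
    · filter_upwards [ht.eventually_lt_const h0] with ε hε
      exact ⟨fun h1 => by linarith, fun h1 => by linarith [h1.1]⟩
    · filter_upwards [self_mem_nhdsWithin] with ε hε
      rw [map_add, map_smul, h0, zero_add, smul_eq_mul, mul_nonneg_iff_of_pos_left hε]
      refine ⟨fun h1 => ⟨le_rfl, fun h2 => by linarith⟩, fun h1 => ?_⟩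
      by_contra h2
      push Not at h2
      exact lt_irrefl _ (h1.2 h2)
    · filter_upwards [ht.eventually_const_lt h0] with ε hε
      exact ⟨fun h1 => ⟨h0.le, fun _ => h0⟩, fun _ => hε.le⟩
  filter_upwards [key] with ε hε
  rw [hσ.mem_cone, hσ.mem_shiftedCone hγ hp]
  exact forall_congr' hε

/-- The condition that the coordinate at b be positive removes a facet: on C(κ) its indicator is
[C(κ)] - [C(κ \ {b})]. Facets are removed one at a time, so κ has to range over all subsets of σ in
the induction. -/
theorem IsBasis.indicator_facets_mem_piecePoly (hσ : IsBasis Δ σ) {P : V → ℝ} (hP : P ∈ polyFun V)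
    (N : Finset V) :
    ∀ κ ⊆ σ, (fun h => P h *
      {h | h ∈ cone κ ∧ ∀ a : σ, (a : V) ∈ N → 0 < hσ.coord a h}.indicator 1 h) ∈ piecePoly Δ := by
  classical
  induction N using Finset.induction_on with
  | empty =>
    intro κ hκ
    exact Submodule.subset_span ⟨P, hP, κ, hκ.trans hσ.1.1, by simp⟩
  | insert b N hb ih =>
    intro κ hκ
    by_cases hbσ : b ∈ σ
    · have h1 := Submodule.sub_mem _ (ih κ hκ) (ih (κ.erase b) ((Finset.erase_subset _ _).trans hκ))
      convert h1 using 1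
      funext h
      rw [Pi.sub_apply, ← mul_sub]
      congr 1
      simp only [Set.indicator_apply, Set.mem_ofPred_eq, Pi.one_apply]
      have e1 : h ∈ cone (κ.erase b) ↔ h ∈ cone κ ∧ hσ.coord ⟨b, hbσ⟩ h = 0 := by
        rw [hσ.mem_cone_subset hκ, hσ.mem_cone_subset ((Finset.erase_subset _ _).trans hκ)]
        constructor
        · intro hh
          refine ⟨fun a => ⟨(hh a).1, fun ha => (hh a).2 fun h' => ha (Finset.mem_of_mem_erase h')⟩,
            (hh ⟨b, hbσ⟩).2 (by simp)⟩
        · rintro ⟨hh, h0⟩ a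
          refine ⟨(hh a).1, fun ha => ?_⟩
          by_cases hab : (a : V) = b
          · have : a = ⟨b, hbσ⟩ := Subtype.ext hab
            rw [this, h0]
          · exact (hh a).2 fun h' => ha (Finset.mem_erase.2 ⟨hab, h'⟩)
      have e2 : (∀ a : σ, (a : V) ∈ insert b N → 0 < hσ.coord a h) ↔
          0 < hσ.coord ⟨b, hbσ⟩ h ∧ ∀ a : σ, (a : V) ∈ N → 0 < hσ.coord a h := by
        constructor
        · intro hh
          exact ⟨hh ⟨b, hbσ⟩ (by simp), fun a ha => hh a (by simp [ha])⟩
        · rintro ⟨h0, hh⟩ a ha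
          rcases Finset.mem_insert.1 ha with hab | ha
          · have : a = ⟨b, hbσ⟩ := Subtype.ext hab
            rw [this]; exact h0
          · exact hh a ha
      simp only [e1, e2]
      by_cases hc : h ∈ cone κ
      · have h0 := ((hσ.mem_cone_subset hκ h).1 hc ⟨b, hbσ⟩).1
        rcases eq_or_lt_of_le h0 with h0 | h0
        · simp [hc, ← h0]
        · simp [hc, h0, h0.ne']
      · simp [hc]
    · have h1 := ih κ hκ
      convert h1 using 6 with h
      refine and_congr_right fun _ => forall_congr' fun a => ?_
      rw [Finset.mem_insert, or_iff_right fun h' : (a : V) = b => hbσ (h' ▸ a.2)]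

theorem IsBasis.shiftedCone_mem_piecePoly (hσ : IsBasis Δ σ) {γ : Set V} (hγ : IsChamber Δ γ)
    {p : V} (hp : p ∈ γ)
    {P : V → ℝ} (hP : P ∈ polyFun V) :
    (fun h => P h * (shiftedCone γ σ).indicator 1 h) ∈ piecePoly Δ := by
  classical
  -- The facets to remove are those whose coordinate is negative at p.
  have h := hσ.indicator_facets_mem_piecePoly hP
    ((Finset.univ.filter fun a : σ => hσ.coord a p < 0).map ⟨_, Subtype.val_injective⟩) σ subset_rfl
  convert h using 5 with h
  ext h
  rw [hσ.mem_shiftedCone hγ hp, Set.mem_ofPred_eq, hσ.mem_cone, ← forall_and]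
  simp

end Shifted

end StratifiedFourier

end

/-! ### Algebra of R_Δ: derivations, the decomposition G_Δ + NG_Δ, partial fractions. -/

noncomputable section

namespace StratifiedFourier

/-! ### Monomials in the inverses of the elements of `Δ` -/

section Bump

variable {X : Type*}

/-- Increase the exponent `n a` by one. -/
def bump (n : X → ℕ) (a : X) : X → ℕ :=
  open Classical in Function.update n a (n a + 1)

theorem bump_self (n : X → ℕ) (a : X) : bump n a a = n a + 1 := by simp [bump]

theorem bump_of_ne (n : X → ℕ) {a b : X} (h : b ≠ a) : bump n a b = n b := by simp [bump, h]

theorem exists_bump {n : X → ℕ} {a : X} (h : 0 < n a) : ∃ m, bump m a = n := by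
  classical
  refine ⟨Function.update n a (n a - 1), funext fun b => ?_⟩
  by_cases hb : b = a
  · subst hb
    rw [bump_self, Function.update_self]
    omega
  · rw [bump_of_ne _ hb, Function.update_of_ne hb]

theorem bump_add_one (m : X → ℕ) (a : X) :
    (fun b => bump m a b + 1) = bump (fun b => m b + 1) a := by
  funext b
  by_cases hb : b = a
  · subst hb
    rw [bump_self, bump_self]
  · rw [bump_of_ne _ hb, bump_of_ne _ hb]

theorem prod_bump {κ : Finset X} {a : X} (ha : a ∈ κ) (n : X → ℕ) (x : X → ℝ) :
    ∏ b ∈ κ, x b ^ bump n a b = (∏ b ∈ κ, x b ^ n b) * x a := by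
  classical
  rw [← Finset.mul_prod_erase κ _ ha, ← Finset.mul_prod_erase κ (fun b => x b ^ n b) ha,
    bump_self, pow_succ]
  have : ∏ b ∈ κ.erase a, x b ^ bump n a b = ∏ b ∈ κ.erase a, x b ^ n b :=
    Finset.prod_congr rfl fun b hb => by rw [bump_of_ne _ (Finset.ne_of_mem_erase hb)]
  rw [this]
  ring

theorem sum_bump {κ : Finset X} {a : X} (ha : a ∈ κ) (n : X → ℕ) :
    ∑ b ∈ κ, bump n a b = (∑ b ∈ κ, n b) + 1 := by
  classical
  rw [← Finset.add_sum_erase κ _ ha, ← Finset.add_sum_erase κ n ha, bump_self,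
    Finset.sum_congr rfl fun _ hb => bump_of_ne n (Finset.ne_of_mem_erase hb)]
  ring

theorem sum_bump_of_notMem {κ : Finset X} {a : X} (ha : a ∉ κ) (n : X → ℕ) :
    ∑ b ∈ κ, bump n a b = ∑ b ∈ κ, n b :=
  Finset.sum_congr rfl fun _ hb => bump_of_ne n fun h => ha (h ▸ hb)

end Bump

variable {V : Type*} [NormedAddCommGroup V] [NormedSpace ℝ V]

theorem invProd_apply {Δ κ : Finset V} (hκ : κ ⊆ Δ) (n : V → ℕ) (y : dualReg Δ) :
    (invProd Δ κ hκ n).1 y = (∏ α ∈ κ, y.1 α ^ n α)⁻¹ :=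
  one_div _

theorem invProd_congr {Δ κ : Finset V} (hκ : κ ⊆ Δ) {n m : V → ℕ} (h : ∀ α ∈ κ, n α = m α) :
    invProd Δ κ hκ n = invProd Δ κ hκ m := by
  refine Subtype.ext (funext fun y => ?_)
  rw [invProd_apply, invProd_apply]
  congr 1
  exact Finset.prod_congr rfl fun α hα => by rw [h α hα]

theorem invProd_bump {Δ κ : Finset V} (hκ : κ ⊆ Δ) (n : V → ℕ) {a : V} (ha : a ∈ κ)
    (y : dualReg Δ) : (invProd Δ κ hκ (bump n a)).1 y = (invProd Δ κ hκ n).1 y * (y.1 a)⁻¹ := by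
  rw [invProd_apply, invProd_apply, prod_bump ha n (fun b => y.1 b), mul_inv]

theorem invProd_subset {Δ κ τ : Finset V} (hτ : τ ⊆ Δ) (hκ : κ ⊆ τ) {n : V → ℕ}
    (h : ∀ α ∈ τ, α ∉ κ → n α = 0) :
    invProd Δ τ hτ n = invProd Δ κ (hκ.trans hτ) n := by
  refine Subtype.ext (funext fun y => ?_)
  rw [invProd_apply, invProd_apply]
  congr 1
  refine (Finset.prod_subset hκ fun α hα hn => ?_).symm
  rw [h α hα hn, pow_zero]

/-- A vector of `V`, as a linear function in `R_Δ`. -/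
def linFun (Δ : Finset V) (v : V) : ratRing Δ :=
  ⟨fun y => y.1 v, Algebra.subset_adjoin (Or.inl ⟨v, rfl⟩)⟩

theorem linFun_mul_invProd_bump {Δ κ : Finset V} (hκ : κ ⊆ Δ) (n : V → ℕ) {a : V} (ha : a ∈ κ) :
    linFun Δ a * invProd Δ κ hκ (bump n a) = invProd Δ κ hκ n := by
  refine Subtype.ext (funext fun y => ?_)
  change y.1 a * (invProd Δ κ hκ (bump n a)).1 y = _
  rw [invProd_bump hκ n ha]
  have := y.2 a (hκ ha)
  field_simp

theorem linFun_sum (Δ κ : Finset V) (c : V → ℝ) :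
    linFun Δ (∑ a ∈ κ, c a • a) = ∑ a ∈ κ, c a • linFun Δ a := by
  refine Subtype.ext (funext fun y => ?_)
  rw [AddSubmonoidClass.coe_finsetSum, Finset.sum_apply]
  change y.1 (∑ a ∈ κ, c a • a) = ∑ a ∈ κ, c a * y.1 a
  simp

/-! ### The directional derivatives as derivations -/

theorem hasLineDerivAt_dirDeriv (Δ : Finset V) (w : StrongDual ℝ V) (φ : ratRing Δ)
    (y : dualReg Δ) :
    HasLineDerivAt ℝ (extendZero φ.1) ((dirDeriv Δ w φ).1 y) y.1 w := by
  obtain ⟨ψ, -, h⟩ := exists_lineDeriv Δ w φ.1 φ.2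
  exact (h y).lineDifferentiableAt.hasLineDerivAt

theorem dirDeriv_eq_of_hasLineDerivAt {Δ : Finset V} {w : StrongDual ℝ V} {φ ψ : ratRing Δ}
    (h : ∀ y : dualReg Δ, HasLineDerivAt ℝ (extendZero φ.1) (ψ.1 y) y.1 w) :
    dirDeriv Δ w φ = ψ :=
  Subtype.ext (funext fun y => (h y).lineDeriv)

/-- The derivation `∂(w)` of `R_Δ`. -/
def dirDerivation (Δ : Finset V) (w : StrongDual ℝ V) :
    Derivation ℝ (ratRing Δ) (ratRing Δ) :=
  Derivation.mk'
    { toFun := dirDeriv Δ w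
      map_add' := fun φ ψ => dirDeriv_eq_of_hasLineDerivAt fun y => by
        have h : (φ + ψ).1 = φ.1 + ψ.1 := rfl
        rw [h, extendZero_add]
        exact HasDerivAt.add (hasLineDerivAt_dirDeriv Δ w φ y) (hasLineDerivAt_dirDeriv Δ w ψ y)
      map_smul' := fun c φ => dirDeriv_eq_of_hasLineDerivAt fun y => by
        have h : extendZero (c • φ).1 = c • extendZero φ.1 := by
          funext x
          by_cases hx : x ∈ dualReg Δ
          · rw [Pi.smul_apply, extendZero_apply _ ⟨x, hx⟩, extendZero_apply _ ⟨x, hx⟩]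
            rfl
          · simp [extendZero, Function.extend_apply', hx]
        rw [h]
        exact HasDerivAt.const_smul c (hasLineDerivAt_dirDeriv Δ w φ y) }
    (fun φ ψ => dirDeriv_eq_of_hasLineDerivAt fun y => by
        have h : (φ * ψ).1 = φ.1 * ψ.1 := rfl
        rw [h, extendZero_mul]
        have h := HasDerivAt.mul (hasLineDerivAt_dirDeriv Δ w φ y)
          (hasLineDerivAt_dirDeriv Δ w ψ y)
        refine HasDerivAt.congr_deriv h ?_
        simp only [zero_smul, add_zero, extendZero_apply]
        change _ = φ.1 y * (dirDeriv Δ w ψ).1 y + ψ.1 y * (dirDeriv Δ w φ).1 y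
        ring)

theorem dirDerivation_apply (Δ : Finset V) (w : StrongDual ℝ V) (φ : ratRing Δ) :
    dirDerivation Δ w φ = dirDeriv Δ w φ := rfl

theorem hasLineDerivAt_apply (v : V) (y w : StrongDual ℝ V) :
    HasLineDerivAt ℝ (fun z : StrongDual ℝ V => z v) (w v) y w := by
  have h := ((hasDerivAt_id (0 : ℝ)).mul_const (w v)).const_add (y v)
  simpa [HasLineDerivAt] using h

theorem dirDerivation_linFun (Δ : Finset V) (w : StrongDual ℝ V) (v : V) :
    dirDerivation Δ w (linFun Δ v) = algebraMap ℝ _ (w v) :=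
  dirDeriv_eq_of_hasLineDerivAt fun y =>
    hasLineDerivAt_congr_dualReg (g := fun z => z v) (fun _ => rfl) (hasLineDerivAt_apply v y.1 w)

theorem dirDerivation_invProd {Δ κ : Finset V} (hκ : κ ⊆ Δ) (w : StrongDual ℝ V) (n : V → ℕ) :
    dirDerivation Δ w (invProd Δ κ hκ n) =
      ∑ a ∈ κ, (-(n a * w a)) • invProd Δ κ hκ (bump n a) := by
  classical
  refine dirDeriv_eq_of_hasLineDerivAt fun y => ?_
  refine hasLineDerivAt_congr_dualReg (g := fun z => ∏ a ∈ κ, (z a ^ n a)⁻¹)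
    (fun z => by rw [invProd_apply, Finset.prod_inv_distrib]) ?_
  have h : ∀ a ∈ κ, HasDerivAt (fun t : ℝ => ((y.1 + t • w) a ^ n a)⁻¹)
      (-(n a * w a) * ((y.1 a ^ n a)⁻¹ * (y.1 a)⁻¹)) 0 := by
    intro a ha
    have hy : y.1 a ≠ 0 := y.2 a (hκ ha)
    have h1 : HasDerivAt (fun t : ℝ => (y.1 + t • w) a) (w a) 0 := hasLineDerivAt_apply a y.1 w
    have h2 := (h1.fun_pow (n a)).fun_inv (by simpa using pow_ne_zero _ hy)
    refine h2.congr_deriv ?_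
    simp only [zero_smul, add_zero]
    rcases Nat.eq_zero_or_pos (n a) with h0 | h0
    · simp [h0]
    · obtain ⟨k, hk⟩ := Nat.exists_eq_add_of_lt h0
      rw [hk]
      simp only [zero_add, Nat.add_sub_cancel]
      field_simp
      ring
  have h3 := HasDerivAt.fun_finsetProd h
  refine h3.congr_deriv ?_
  rw [AddSubmonoidClass.coe_finsetSum, Finset.sum_apply]
  refine Finset.sum_congr rfl fun a ha => ?_
  change _ = (-(n a * w a)) * (invProd Δ κ hκ (bump n a)).1 y
  rw [invProd_bump hκ n ha, invProd_apply, ← Finset.prod_inv_distrib,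
    ← Finset.mul_prod_erase κ _ ha]
  simp only [zero_smul, add_zero, smul_eq_mul]
  ring

/-- By the Leibniz rule it is enough to check generators: linear functions have constant first
derivatives, and on 1/α both orders give 2 v(α) w(α) / α³. -/
theorem dirDerivation_comm (Δ : Finset V) (v w : StrongDual ℝ V) (φ : ratRing Δ) :
    dirDerivation Δ v (dirDerivation Δ w φ) = dirDerivation Δ w (dirDerivation Δ v φ) := by
  obtain ⟨φ, hφ⟩ := φ
  induction hφ using Algebra.adjoin_induction with
  | mem φ h =>
    rcases h with ⟨u, rfl⟩ | ⟨α, hα, rfl⟩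
    · change dirDerivation Δ v (dirDerivation Δ w (linFun Δ u)) =
        dirDerivation Δ w (dirDerivation Δ v (linFun Δ u))
      simp [dirDerivation_linFun]
    · have h : ({α} : Finset V) ⊆ Δ := by simpa using hα
      have e : (⟨fun y : dualReg Δ => (y.1 α)⁻¹, Algebra.subset_adjoin (Or.inr ⟨α, hα, rfl⟩)⟩ :
          ratRing Δ) = invProd Δ {α} h fun _ => 1 :=
        Subtype.ext (funext fun y => by simp [invProd_apply])
      rw [e]
      simp only [dirDerivation_invProd, Finset.sum_singleton, Derivation.map_smul, smul_smul]
      congr 1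
      ring
  | algebraMap r =>
    change dirDerivation Δ v (dirDerivation Δ w (algebraMap ℝ (ratRing Δ) r)) =
      dirDerivation Δ w (dirDerivation Δ v (algebraMap ℝ (ratRing Δ) r))
    simp
  | add f g hf hg ihf ihg =>
    have e : (⟨f + g, add_mem hf hg⟩ : ratRing Δ) = ⟨f, hf⟩ + ⟨g, hg⟩ := rfl
    rw [e]
    simp only [map_add, ihf, ihg]
  | mul f g hf hg ihf ihg =>
    have e : (⟨f * g, mul_mem hf hg⟩ : ratRing Δ) = ⟨f, hf⟩ * ⟨g, hg⟩ := rfl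
    rw [e]
    simp only [Derivation.leibniz, map_add, smul_eq_mul, ihf, ihg]
    ring

/-! ### Polynomials in `R_Δ`, and the space `NG_Δ` -/

/-- `S(V)`, as a subalgebra of `R_Δ`. -/
def polySubalgebra (Δ : Finset V) : Subalgebra ℝ (ratRing Δ) :=
  Algebra.adjoin ℝ (Set.range (linFun Δ))

theorem exists_mem_polySubalgebra (Δ : Finset V) {ψ : StrongDual ℝ V → ℝ}
    (hψ : ψ ∈ dualPolyFun V) : ∃ Ψ ∈ polySubalgebra Δ, ∀ y : dualReg Δ, Ψ.1 y = ψ y.1 := by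
  induction hψ using Algebra.adjoin_induction with
  | mem ψ h =>
    obtain ⟨v, rfl⟩ := h
    exact ⟨linFun Δ v, Algebra.subset_adjoin ⟨v, rfl⟩, fun y => rfl⟩
  | algebraMap r => exact ⟨algebraMap ℝ _ r, Subalgebra.algebraMap_mem _ r, fun y => rfl⟩
  | add f g _ _ hf hg =>
    obtain ⟨F, hF, hf⟩ := hf
    obtain ⟨K, hK, hg⟩ := hg
    refine ⟨F + K, add_mem hF hK, fun y => ?_⟩
    change F.1 y + K.1 y = f y.1 + g y.1
    rw [hf, hg]
  | mul f g _ _ hf hg =>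
    obtain ⟨F, hF, hf⟩ := hf
    obtain ⟨K, hK, hg⟩ := hg
    refine ⟨F * K, mul_mem hF hK, fun y => ?_⟩
    change F.1 y * K.1 y = f y.1 * g y.1
    rw [hf, hg]

theorem exists_mem_dualPolyFun {Δ : Finset V} {Ψ : ratRing Δ} (hΨ : Ψ ∈ polySubalgebra Δ) :
    ∃ ψ ∈ dualPolyFun V, ∀ y : dualReg Δ, Ψ.1 y = ψ y.1 := by
  induction hΨ using Algebra.adjoin_induction with
  | mem Ψ h =>
    obtain ⟨v, rfl⟩ := h
    exact ⟨fun y => y v, Algebra.subset_adjoin ⟨v, rfl⟩, fun y => rfl⟩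
  | algebraMap r => exact ⟨algebraMap ℝ _ r, Subalgebra.algebraMap_mem _ r, fun y => rfl⟩
  | add F K _ _ hF hK =>
    obtain ⟨f, hf, hF⟩ := hF
    obtain ⟨g, hg, hK⟩ := hK
    refine ⟨f + g, add_mem hf hg, fun y => ?_⟩
    change F.1 y + K.1 y = f y.1 + g y.1
    rw [hF, hK]
  | mul F K _ _ hF hK =>
    obtain ⟨f, hf, hF⟩ := hF
    obtain ⟨g, hg, hK⟩ := hK
    refine ⟨f * g, mul_mem hf hg, fun y => ?_⟩
    change F.1 y * K.1 y = f y.1 * g y.1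
    rw [hF, hK]

/-- Generators become products inside R_Δ, where the Leibniz rule applies. -/
theorem NG_eq_span (Δ : Finset V) :
    NG Δ = Submodule.span ℝ {φ | ∃ (κ : Finset V) (hκ : κ ⊆ Δ) (_ : ¬ IsGenerating Δ κ)
      (n : V → ℕ), ∃ Ψ ∈ polySubalgebra Δ, φ = Ψ * invProd Δ κ hκ n} := by
  refine le_antisymm (Submodule.span_mono ?_) (Submodule.span_mono ?_)
  · rintro φ ⟨κ, hκ, hg, n, ψ, hψ, h⟩
    obtain ⟨Ψ, hΨ, hy⟩ := exists_mem_polySubalgebra Δ hψ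
    refine ⟨κ, hκ, hg, n, Ψ, hΨ, Subtype.ext (funext fun y => ?_)⟩
    change _ = Ψ.1 y * (invProd Δ κ hκ n).1 y
    rw [h, hy, invProd_apply, div_eq_mul_inv]
  · rintro φ ⟨κ, hκ, hg, n, Ψ, hΨ, rfl⟩
    obtain ⟨ψ, hψ, hy⟩ := exists_mem_dualPolyFun hΨ
    refine ⟨κ, hκ, hg, n, ψ, hψ, fun y => ?_⟩
    change Ψ.1 y * (invProd Δ κ hκ n).1 y = _
    rw [hy, invProd_apply, div_eq_mul_inv]

theorem dirDerivation_mem_polySubalgebra {Δ : Finset V} (w : StrongDual ℝ V) {Ψ : ratRing Δ}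
    (hΨ : Ψ ∈ polySubalgebra Δ) : dirDerivation Δ w Ψ ∈ polySubalgebra Δ := by
  induction hΨ using Algebra.adjoin_induction with
  | mem Ψ h =>
    obtain ⟨v, rfl⟩ := h
    rw [dirDerivation_linFun]
    exact Subalgebra.algebraMap_mem _ _
  | algebraMap r =>
    rw [Derivation.map_algebraMap]
    exact zero_mem _
  | add F K _ _ hF hK =>
    rw [map_add]
    exact add_mem hF hK
  | mul F K hFm hKm hF hK =>
    rw [Derivation.leibniz]
    exact add_mem (mul_mem hFm hK) (mul_mem hKm hF)

theorem dirDerivation_mem_NG {Δ : Finset V} (w : StrongDual ℝ V) {φ : ratRing Δ}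
    (hφ : φ ∈ NG Δ) : dirDerivation Δ w φ ∈ NG Δ := by
  rw [NG_eq_span] at hφ ⊢
  induction hφ using Submodule.span_induction with
  | mem φ h =>
    obtain ⟨κ, hκ, hg, n, Ψ, hΨ, rfl⟩ := h
    rw [Derivation.leibniz, dirDerivation_invProd, smul_eq_mul, smul_eq_mul, Finset.mul_sum,
      mul_comm (invProd Δ κ hκ n)]
    refine add_mem (sum_mem fun a _ => ?_) (Submodule.subset_span
      ⟨κ, hκ, hg, n, _, dirDerivation_mem_polySubalgebra w hΨ, rfl⟩)
    rw [mul_smul_comm]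
    exact Submodule.smul_mem _ _ (Submodule.subset_span ⟨κ, hκ, hg, _, Ψ, hΨ, rfl⟩)
  | zero => simp
  | add x y _ _ hx hy => rw [map_add]; exact add_mem hx hy
  | smul c x _ hx => rw [Derivation.map_smul]; exact Submodule.smul_mem _ _ hx

/-! ### Elements of `NG_Δ` are killed by products of derivatives -/

/-- Each application of D falls on one of the two factors, so after N + M applications one factor is
already zero. -/
theorem iterate_derivation_mul_eq_zero {A : Type*} [CommRing A] [Algebra ℝ A]
    (D : Derivation ℝ A A) : ∀ (k N M : ℕ) (f g : A), N + M ≤ k → (D^[N]) f = 0 → (D^[M]) g = 0 →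
      (D^[k]) (f * g) = 0 := by
  have hz : ∀ k : ℕ, (D^[k]) 0 = 0 := fun k => Function.iterate_fixed (map_zero D) k
  have ha : ∀ (k : ℕ) (x y : A), (D^[k]) (x + y) = (D^[k]) x + (D^[k]) y := fun k x y =>
    iterate_map_add D k x y
  intro k
  induction k with
  | zero =>
    intro N M f g h hf hg
    obtain rfl : N = 0 := by omega
    simp only [Function.iterate_zero, id_eq] at hf
    simp [hf]
  | succ k ih =>
    intro N M f g h hf hg
    rcases N with _ | N
    · simp only [Function.iterate_zero, id_eq] at hf
      rw [hf, zero_mul, hz]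
    rcases M with _ | M
    · simp only [Function.iterate_zero, id_eq] at hg
      rw [hg, mul_zero, hz]
    rw [Function.iterate_succ_apply, Derivation.leibniz, ha, smul_eq_mul, smul_eq_mul]
    rw [ih (N + 1) M f (D g) (by omega) hf (by rwa [Function.iterate_succ_apply] at hg),
      ih (M + 1) N g (D f) (by omega) hg (by rwa [Function.iterate_succ_apply] at hf), add_zero]

theorem exists_iterate_dirDerivation_eq_zero {Δ : Finset V} (w : StrongDual ℝ V) {Ψ : ratRing Δ}
    (hΨ : Ψ ∈ polySubalgebra Δ) : ∃ N : ℕ, ((dirDerivation Δ w)^[N]) Ψ = 0 := by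
  have hz : ∀ k : ℕ, ((dirDerivation Δ w)^[k]) 0 = 0 := fun k => Function.iterate_fixed
    (map_zero _) k
  induction hΨ using Algebra.adjoin_induction with
  | mem Ψ h =>
    obtain ⟨v, rfl⟩ := h
    refine ⟨2, ?_⟩
    simp [dirDerivation_linFun]
  | algebraMap r => exact ⟨1, by simp⟩
  | add F K _ _ hF hK =>
    obtain ⟨N, hN⟩ := hF
    obtain ⟨M, hM⟩ := hK
    refine ⟨N + M, ?_⟩
    rw [iterate_map_add, Function.iterate_add_apply _ N M K, hM, hz, add_zero,
      add_comm N M, Function.iterate_add_apply, hN, hz]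
  | mul F K _ _ hF hK =>
    obtain ⟨N, hN⟩ := hF
    obtain ⟨M, hM⟩ := hK
    exact ⟨N + M, iterate_derivation_mul_eq_zero _ _ N M F K le_rfl hN hM⟩

/-- The products of directional derivatives along nonzero directions. -/
def derivMonoid (Δ : Finset V) : Submonoid (Module.End ℝ (ratRing Δ)) :=
  Submonoid.closure {A | ∃ w : StrongDual ℝ V, w ≠ 0 ∧ A = (dirDerivation Δ w).toLinearMap}

theorem derivMonoid_comm {Δ : Finset V} {A B : Module.End ℝ (ratRing Δ)}
    (hA : A ∈ derivMonoid Δ) (hB : B ∈ derivMonoid Δ) : A * B = B * A := by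
  induction hA, hB using Submonoid.closure_induction₂ with
  | mem x y hx hy =>
    obtain ⟨v, -, rfl⟩ := hx
    obtain ⟨w, -, rfl⟩ := hy
    exact LinearMap.ext fun φ => dirDerivation_comm Δ v w φ
  | one_left => rw [one_mul, mul_one]
  | one_right => rw [one_mul, mul_one]
  | mul_left x y z _ _ _ h1 h2 => rw [mul_assoc, h2, ← mul_assoc, h1, mul_assoc]
  | mul_right x y z _ _ _ h1 h2 => rw [← mul_assoc, h1, mul_assoc, h2, mul_assoc]

theorem exists_ne_zero_dual_of_span_ne_top [FiniteDimensional ℝ V] {κ : Finset V}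
    (h : Submodule.span ℝ (κ : Set V) ≠ ⊤) : ∃ w : StrongDual ℝ V, w ≠ 0 ∧ ∀ a ∈ κ, w a = 0 := by
  obtain ⟨f, hf, hle⟩ := Submodule.exists_le_ker_of_lt_top _ (lt_top_iff_ne_top.2 h)
  refine ⟨LinearMap.toContinuousLinearMap f, ?_, fun a ha => ?_⟩
  · simpa using hf
  · exact hle (Submodule.subset_span ha)

/-- A nonzero w vanishing on κ differentiates the denominator to zero and is nilpotent on the
polynomial numerator. A sum is killed by the product of the operators killing its terms, because
these operators commute. -/
theorem exists_derivMonoid_eq_zero_of_mem_NG [FiniteDimensional ℝ V] {Δ : Finset V}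
    {φ : ratRing Δ} (hφ : φ ∈ NG Δ) : ∃ A ∈ derivMonoid Δ, A φ = 0 := by
  rw [NG_eq_span] at hφ
  induction hφ using Submodule.span_induction with
  | mem φ h =>
    obtain ⟨κ, hκ, hg, n, Ψ, hΨ, rfl⟩ := h
    obtain ⟨w, hw0, hw⟩ := exists_ne_zero_dual_of_span_ne_top (κ := κ) fun h => hg ⟨hκ, h⟩
    obtain ⟨N, hN⟩ := exists_iterate_dirDerivation_eq_zero w hΨ
    have hmem : (dirDerivation Δ w).toLinearMap ∈ derivMonoid Δ :=
      Submonoid.subset_closure ⟨w, hw0, rfl⟩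
    -- N applications for the numerator and one for the denominator.
    refine ⟨(dirDerivation Δ w).toLinearMap ^ (N + 1), pow_mem hmem _, ?_⟩
    rw [Module.End.pow_apply]
    refine iterate_derivation_mul_eq_zero (dirDerivation Δ w) (N + 1) N 1 _ _ le_rfl hN ?_
    rw [Function.iterate_one, dirDerivation_invProd]
    exact Finset.sum_eq_zero fun a ha => by simp [hw a ha]
  | zero => exact ⟨1, one_mem _, map_zero _⟩
  | add x y _ _ hx hy =>
    obtain ⟨A, hA, hAx⟩ := hx
    obtain ⟨B, hB, hBy⟩ := hy
    refine ⟨A * B, mul_mem hA hB, ?_⟩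
    rw [map_add, Module.End.mul_apply, Module.End.mul_apply, hBy, map_zero, add_zero,
      ← Module.End.mul_apply, derivMonoid_comm hA hB, Module.End.mul_apply, hAx, map_zero]
  | smul c x _ hx =>
    obtain ⟨A, hA, hAx⟩ := hx
    exact ⟨A, hA, by rw [map_smul, hAx, smul_zero]⟩

/-! ### The decomposition `R_Δ = G_Δ + NG_Δ` -/

/-- All of Δ is the common denominator, with zero exponents allowed. As long as the α of nonzero
exponent generate V, a linear factor of the numerator is a combination of them and each term cancels
one power of one α. Once they fail to generate, the fraction is in NG_Δ. -/
theorem monomial_mul_invProd_mem (Δ : Finset V) {Ψ : ratRing Δ}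
    (hΨ : Ψ ∈ Submonoid.closure (Set.range (linFun Δ))) :
    ∀ n : V → ℕ, Ψ * invProd Δ Δ subset_rfl n ∈ G Δ ⊔ NG Δ := by
  classical
  have hng : ∀ Ψ ∈ Submonoid.closure (Set.range (linFun Δ)), ∀ n : V → ℕ,
      ¬ IsGenerating Δ (Δ.filter fun a => n a ≠ 0) →
      Ψ * invProd Δ Δ subset_rfl n ∈ G Δ ⊔ NG Δ := by
    intro Ψ hΨ n hn
    refine Submodule.mem_sup_right ?_
    rw [NG_eq_span, invProd_subset subset_rfl (Finset.filter_subset (fun a => n a ≠ 0) Δ)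
      fun α hα h => by simpa [hα] using h]
    exact Submodule.subset_span ⟨_, _, hn, n, Ψ,
      Submonoid.closure_le.2 Algebra.subset_adjoin hΨ, rfl⟩
  induction hΨ using Submonoid.closure_induction_left with
  | one =>
    intro n
    by_cases hn : IsGenerating Δ (Δ.filter fun a => n a ≠ 0)
    · refine Submodule.mem_sup_left ?_
      rw [one_mul, invProd_subset subset_rfl (Finset.filter_subset (fun a => n a ≠ 0) Δ)
        fun α hα h => by simpa [hα] using h]
      exact Submodule.subset_span ⟨_, hn, n,
        fun a ha => Nat.pos_of_ne_zero (Finset.mem_filter.1 ha).2, rfl⟩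
    · exact hng 1 (one_mem _) n hn
  | mul_left x hx Ψ hΨ ih =>
    intro n
    by_cases hn : IsGenerating Δ (Δ.filter fun a => n a ≠ 0)
    · obtain ⟨v, rfl⟩ := hx
      have hv : v ∈ Submodule.span ℝ ((Δ.filter fun a => n a ≠ 0 : Finset V) : Set V) := by
        rw [hn.2]; trivial
      obtain ⟨c, -, rfl⟩ := Submodule.mem_span_finset.1 hv
      rw [linFun_sum, mul_assoc, Finset.sum_mul]
      refine sum_mem fun a ha => ?_
      obtain ⟨haΔ, ha0⟩ := Finset.mem_filter.1 ha
      obtain ⟨m, rfl⟩ := exists_bump (Nat.pos_of_ne_zero ha0)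
      rw [smul_mul_assoc, mul_left_comm, linFun_mul_invProd_bump _ _ haΔ]
      exact Submodule.smul_mem _ _ (ih m)
    · exact hng _ (mul_mem (Submonoid.subset_closure hx) hΨ) n hn

theorem G_sup_NG (Δ : Finset V) : G Δ ⊔ NG Δ = ⊤ := by
  classical
  rw [eq_top_iff]
  rintro ⟨φ, hφ⟩ -
  have hφ' : φ ∈ Subalgebra.toSubmodule (ratRing Δ) := hφ
  rw [ratRing, Algebra.adjoin_eq_span] at hφ'
  have key : φ ∈ (G Δ ⊔ NG Δ).map (ratRing Δ).val.toLinearMap := by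
    refine Submodule.span_le.2 ?_ hφ'
    intro m hm
    -- A monomial in the generators of R_Δ is a product of linear functions over the common
    -- denominator.
    have : ∃ Ψ ∈ Submonoid.closure (Set.range (linFun Δ)), ∃ n : V → ℕ,
        (Ψ * invProd Δ Δ subset_rfl n).1 = m := by
      induction hm using Submonoid.closure_induction with
      | mem m h =>
        rcases h with ⟨v, rfl⟩ | ⟨α, hα, rfl⟩
        · refine ⟨linFun Δ v, Submonoid.subset_closure ⟨v, rfl⟩, 0, funext fun y => ?_⟩
          change y.1 v * (invProd Δ Δ subset_rfl 0).1 y = y.1 v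
          simp [invProd_apply]
        · refine ⟨1, one_mem _, bump 0 α, funext fun y => ?_⟩
          rw [one_mul, invProd_bump _ _ hα]
          simp [invProd_apply]
      | one =>
        refine ⟨1, one_mem _, 0, funext fun y => ?_⟩
        rw [one_mul]
        simp [invProd_apply]
      | mul f g _ _ hf hg =>
        obtain ⟨Ψ, hΨ, n, rfl⟩ := hf
        obtain ⟨Ψ', hΨ', n', rfl⟩ := hg
        refine ⟨Ψ * Ψ', mul_mem hΨ hΨ', n + n', funext fun y => ?_⟩
        change Ψ.1 y * Ψ'.1 y * (invProd Δ Δ subset_rfl (n + n')).1 y =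
          Ψ.1 y * (invProd Δ Δ subset_rfl n).1 y * (Ψ'.1 y * (invProd Δ Δ subset_rfl n').1 y)
        simp only [invProd_apply, Pi.add_apply, pow_add, Finset.prod_mul_distrib, mul_inv]
        ring
    obtain ⟨Ψ, hΨ, n, rfl⟩ := this
    exact ⟨_, monomial_mul_invProd_mem Δ hΨ n, rfl⟩
  obtain ⟨x, hx, hxφ⟩ := key
  have : x = ⟨φ, hφ⟩ := Subtype.ext hxφ
  exact this ▸ hx

/-! ### Partial fractions -/

/-- The functions `1 / ∏_{a ∈ σ} a ^ (m a + 1)`, where `σ ⊆ Δ` is a basis of `V`. -/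
def IsBasis.frac {Δ σ : Finset V} (hσ : IsBasis Δ σ) (m : V → ℕ) : ratRing Δ :=
  invProd Δ σ hσ.1.1 fun a => m a + 1

/-- The span of the fractions attached to the bases on which `y` is positive. -/
def posFracSpan (Δ : Finset V) (y : StrongDual ℝ V) : Submodule ℝ (ratRing Δ) :=
  Submodule.span ℝ {φ | ∃ (σ : Finset V) (hσ : IsBasis Δ σ) (_ : ∀ a ∈ σ, 0 < y a) (m : V → ℕ),
    φ = hσ.frac m}

/-- Each α is replaced by whichever of α, -α is positive at y, at the price of a sign. -/
theorem exists_invProd_flip {Δ κ : Finset V} (hneg : ∀ α ∈ Δ, -α ∈ Δ) {y : StrongDual ℝ V}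
    (hy : y ∈ dualReg Δ) (hκ : IsGenerating Δ κ) {n : V → ℕ} (hn : ∀ α ∈ κ, 0 < n α) :
    ∃ (τ : Finset V) (hτ : IsGenerating Δ τ) (m : V → ℕ) (c : ℝ), (∀ α ∈ τ, 0 < m α) ∧
      (∀ α ∈ τ, 0 < y α) ∧ invProd Δ κ hκ.1 n = c • invProd Δ τ hτ.1 m := by
  classical
  let s : V → ℝ := fun α => if 0 < y α then 1 else -1
  let f : V → V := fun α => s α • α
  have hs : ∀ α, s α * s α = 1 := fun α => by by_cases h : 0 < y α <;> simp [s, h]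
  have hf : ∀ α ∈ κ, f α ∈ Δ := by
    intro α hα
    by_cases h : 0 < y α
    · simpa [f, s, h] using hκ.1 hα
    · simpa [f, s, h] using hneg α (hκ.1 hα)
  have hspan : Submodule.span ℝ ((κ.image f : Finset V) : Set V) = ⊤ := by
    rw [eq_top_iff, ← hκ.2, Submodule.span_le]
    intro α hα
    have h1 : s α • f α = α := by rw [smul_smul, hs, one_smul]
    rw [← h1]
    exact Submodule.smul_mem _ _ (Submodule.subset_span (Finset.mem_image_of_mem f hα))
  -- κ may contain both α and -α; they have the same image, so exponents are added over the fibres.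
  refine ⟨κ.image f, ⟨fun β hβ => ?_, hspan⟩, fun β => ∑ α ∈ κ with f α = β, n α,
    ∏ α ∈ κ, s α ^ n α, ?_, ?_, ?_⟩
  · obtain ⟨α, hα, rfl⟩ := Finset.mem_image.1 hβ
    exact hf α hα
  · intro β hβ
    obtain ⟨α, hα, rfl⟩ := Finset.mem_image.1 hβ
    exact Finset.sum_pos (fun α hα => hn α (Finset.mem_filter.1 hα).1) ⟨α, by simp [hα]⟩
  · intro β hβ
    obtain ⟨α, hα, rfl⟩ := Finset.mem_image.1 hβ
    have h0 := hy α (hκ.1 hα)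
    by_cases h : 0 < y α
    · simp [f, s, h]
    · have : y α < 0 := lt_of_le_of_ne (not_lt.1 h) h0
      simpa [f, s, h] using this
  · refine Subtype.ext (funext fun z => ?_)
    change (invProd Δ κ hκ.1 n).1 z = (∏ α ∈ κ, s α ^ n α) * (invProd Δ (κ.image f) _ _).1 z
    rw [invProd_apply, invProd_apply]
    have h1 : ∏ β ∈ κ.image f, z.1 β ^ ∑ α ∈ κ with f α = β, n α = ∏ α ∈ κ, z.1 (f α) ^ n α := by
      rw [← Finset.prod_fiberwise_of_maps_to (t := κ.image f) (g := f)
        fun α hα => Finset.mem_image_of_mem f hα]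
      refine Finset.prod_congr rfl fun β _ => ?_
      rw [← Finset.prod_pow_eq_pow_sum]
      exact Finset.prod_congr rfl fun α hα => by rw [(Finset.mem_filter.1 hα).2]
    rw [h1, ← Finset.prod_inv_distrib, ← Finset.prod_inv_distrib, ← Finset.prod_mul_distrib]
    refine Finset.prod_congr rfl fun α hα => ?_
    have h2 : s α ≠ 0 := fun h => by simpa [h] using hs α
    have h3 := z.2 α (hκ.1 hα)
    have h4 : z.1 (f α) = s α * z.1 α := by simp [f]
    rw [h4, mul_pow, mul_inv, ← mul_assoc, mul_inv_cancel₀ (pow_ne_zero _ h2), one_mul]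

/-- If κ is dependent, some a ∈ κ is a combination ∑ d_b b of the others. Multiplying by a/a and
expanding the numerator trades one power of b for one power of a. Repeating this, some b disappears
from the denominator, and what is left is a smaller generating set. The inductions are on the size
of κ and on the total exponent outside a. -/
theorem invProd_mem_posFracSpan {Δ : Finset V} {y : StrongDual ℝ V} :
    ∀ (k : ℕ) (κ : Finset V) (_ : κ.card = k) (hκ : IsGenerating Δ κ) (_ : ∀ α ∈ κ, 0 < y α)
      (n : V → ℕ) (_ : ∀ α ∈ κ, 0 < n α), invProd Δ κ hκ.1 n ∈ posFracSpan Δ y := by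
  classical
  intro k
  induction k with
  | zero =>
    intro κ hk hκ hy n hn
    obtain rfl : κ = ∅ := Finset.card_eq_zero.1 hk
    refine Submodule.subset_span ⟨∅, ⟨hκ, linearIndependent_empty_type⟩, hy, 0, ?_⟩
    exact invProd_congr _ (by simp)
  | succ k ih =>
    intro κ hk hκ hy n hn
    by_cases hli : LinearIndependent ℝ (fun a : κ => (a : V))
    · refine Submodule.subset_span ⟨κ, ⟨hκ, hli⟩, hy, fun a => n a - 1, ?_⟩
      refine invProd_congr _ fun a ha => ?_
      have := hn a ha
      change n a = n a - 1 + 1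
      omega
    rw [linearIndependent_iff_notMem_span] at hli
    push Not at hli
    obtain ⟨⟨a, ha⟩, hspan⟩ := hli
    have hspan' : a ∈ Submodule.span ℝ ((κ.erase a : Finset V) : Set V) := by
      refine Submodule.span_mono ?_ hspan
      rintro _ ⟨b, hb, rfl⟩
      simp only [Finset.coe_erase, Set.mem_sdiff, Finset.mem_coe, Set.mem_singleton_iff]
      exact ⟨b.2, fun h => hb.2 (Subtype.ext h)⟩
    obtain ⟨d, -, hd⟩ := Submodule.mem_span_finset.1 hspan'
    have key : ∀ (N : ℕ) (n : V → ℕ), (∀ α ∈ κ, 0 < n α) → ∑ b ∈ κ.erase a, n b = N →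
        invProd Δ κ hκ.1 n ∈ posFracSpan Δ y := by
      intro N
      induction N with
      | zero =>
        intro n hn hN
        have hempty : κ.erase a = ∅ := by
          by_contra hne
          obtain ⟨b, hb⟩ := Finset.nonempty_iff_ne_empty.2 hne
          have h1 := (Finset.sum_eq_zero_iff.1 hN) b hb
          have h2 := hn b (Finset.mem_of_mem_erase hb)
          omega
        -- With nothing left besides a, the relation says a = 0, against 0 < y a.
        rw [hempty, Finset.sum_empty] at hd
        have := hy a ha
        rw [← hd, map_zero] at this
        exact absurd this (lt_irrefl _)
      | succ N ihN =>
        intro n hn hN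
        have hexp : invProd Δ κ hκ.1 n = ∑ b ∈ κ.erase a,
            d b • (linFun Δ b * invProd Δ κ hκ.1 (bump n a)) := by
          rw [← linFun_mul_invProd_bump hκ.1 n ha]
          conv_lhs => rw [← hd, linFun_sum, Finset.sum_mul]
          refine Finset.sum_congr rfl fun b _ => ?_
          rw [hd, smul_mul_assoc]
        rw [hexp]
        refine sum_mem fun b hb => ?_
        obtain ⟨hba, hbκ⟩ := Finset.mem_erase.1 hb
        by_cases hdb : d b = 0
        · rw [hdb, zero_smul]; exact zero_mem _
        refine Submodule.smul_mem _ _ ?_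
        obtain ⟨m, hm⟩ : ∃ m, bump m b = bump n a :=
          exists_bump (by rw [bump_of_ne _ hba]; exact hn b hbκ)
        rw [← hm, linFun_mul_invProd_bump _ _ hbκ]
        have hmn : ∀ c ∈ κ, c ≠ b → 0 < m c := by
          intro c hc hcb
          rw [← bump_of_ne m hcb, hm]
          by_cases hca : c = a
          · rw [hca, bump_self]; omega
          · rw [bump_of_ne _ hca]; exact hn c hc
        rcases Nat.eq_zero_or_pos (m b) with h0 | h0
        -- The exponent of b has reached zero. As d_b ≠ 0, the relation can be solved for b, so κ
        -- without b still generates.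
        · have hgen : IsGenerating Δ (κ.erase b) := by
            refine ⟨(Finset.erase_subset _ _).trans hκ.1, ?_⟩
            rw [eq_top_iff, ← hκ.2, Submodule.span_le]
            have hsub : ∀ c ∈ κ, c ≠ b →
                c ∈ Submodule.span ℝ ((κ.erase b : Finset V) : Set V) := fun c hc hcb =>
              Submodule.subset_span (Finset.mem_coe.2 (Finset.mem_erase.2 ⟨hcb, hc⟩))
            intro c hc
            by_cases hcb : c = b
            · rw [hcb]
              rw [← Finset.add_sum_erase _ _ hb] at hd
              have h1 : d b • b = a - ∑ x ∈ (κ.erase a).erase b, d x • x := by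
                exact eq_sub_of_add_eq hd
              refine (Submodule.smul_mem_iff _ hdb).1 ?_
              change d b • b ∈ _
              rw [h1]
              refine sub_mem (hsub a ha (Ne.symm hba)) (sum_mem fun x hx => ?_)
              obtain ⟨hxb, hx⟩ := Finset.mem_erase.1 hx
              exact Submodule.smul_mem _ _ (hsub x (Finset.mem_of_mem_erase hx) hxb)
            · exact hsub c hc hcb
          rw [invProd_subset hκ.1 (Finset.erase_subset b κ)]
          · exact ih (κ.erase b) (by rw [Finset.card_erase_of_mem hbκ, hk]; rfl) hgen
              (fun c hc => hy c (Finset.mem_of_mem_erase hc)) m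
              fun c hc => hmn c (Finset.mem_of_mem_erase hc) (Finset.ne_of_mem_erase hc)
          · intro c hc hnc
            have : c = b := by
              by_contra hcb
              exact hnc (Finset.mem_erase.2 ⟨hcb, hc⟩)
            rw [this, h0]
        · refine ihN m (fun c hc => ?_) ?_
          · by_cases hcb : c = b
            · rw [hcb]; exact h0
            · exact hmn c hc hcb
          · have h1 := sum_bump hb m
            rw [hm, sum_bump_of_notMem (Finset.notMem_erase a κ), hN] at h1
            omega
    exact key _ n hn rfl

theorem G_eq_posFracSpan {Δ : Finset V} (hneg : ∀ α ∈ Δ, -α ∈ Δ) {y : StrongDual ℝ V}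
    (hy : y ∈ dualReg Δ) : G Δ = posFracSpan Δ y := by
  refine le_antisymm (Submodule.span_le.2 ?_) (Submodule.span_mono ?_)
  · rintro φ ⟨κ, hκ, n, hn, rfl⟩
    obtain ⟨τ, hτ, m, c, hm, hτy, h⟩ := exists_invProd_flip hneg hy hκ hn
    rw [h]
    exact Submodule.smul_mem _ _ (invProd_mem_posFracSpan _ τ rfl hτ hτy m hm)
  · rintro φ ⟨σ, hσ, -, m, rfl⟩
    exact ⟨σ, hσ.1, fun a => m a + 1, fun a _ => Nat.succ_pos _, rfl⟩

theorem IsBasis.dirDerivation_frac {Δ σ : Finset V} (hσ : IsBasis Δ σ) (w : StrongDual ℝ V)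
    (m : V → ℕ) :
    dirDerivation Δ w (hσ.frac m) = ∑ a ∈ σ, (-(((m a : ℝ) + 1) * w a)) • hσ.frac (bump m a) := by
  rw [IsBasis.frac, dirDerivation_invProd]
  refine Finset.sum_congr rfl fun a _ => ?_
  rw [IsBasis.frac, bump_add_one]
  push_cast
  rfl

theorem dirDerivation_mem_posFracSpan {Δ : Finset V} {y : StrongDual ℝ V} (w : StrongDual ℝ V)
    {φ : ratRing Δ} (hφ : φ ∈ posFracSpan Δ y) : dirDerivation Δ w φ ∈ posFracSpan Δ y := by
  induction hφ using Submodule.span_induction with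
  | mem φ h =>
    obtain ⟨σ, hσ, hy, m, rfl⟩ := h
    rw [hσ.dirDerivation_frac]
    exact sum_mem fun a _ => Submodule.smul_mem _ _ (Submodule.subset_span ⟨σ, hσ, hy, _, rfl⟩)
  | zero => simp
  | add x y _ _ hx hy => rw [map_add]; exact add_mem hx hy
  | smul c x _ hx => rw [Derivation.map_smul]; exact Submodule.smul_mem _ _ hx

end StratifiedFourier

end

/-! ### Laplace transforms of piecewise polynomial functions and their injectivity. -/

noncomputable section

namespace StratifiedFourier

variable {V : Type*} [NormedAddCommGroup V] [NormedSpace ℝ V]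

/-! ### Polynomial functions in the coordinates of a basis -/

theorem polyFun_continuous {P : V → ℝ} (hP : P ∈ polyFun V) : Continuous P := by
  induction hP using Algebra.adjoin_induction with
  | mem P h => obtain ⟨y, rfl⟩ := h; exact y.continuous
  | algebraMap r => exact continuous_const
  | add f g _ _ hf hg => exact hf.add hg
  | mul f g _ _ hf hg => exact hf.mul hg

theorem dual_mem_polyFun (y : StrongDual ℝ V) : (fun h => y h) ∈ polyFun V :=
  Algebra.subset_adjoin ⟨y, rfl⟩

/-- A linear form is a combination of the coordinates, so the span of the coordinate monomials is
stable under multiplication by linear forms. -/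
theorem IsBasis.polyFun_mem_span [FiniteDimensional ℝ V] {Δ σ : Finset V} (hσ : IsBasis Δ σ)
    {P : V → ℝ}
    (hP : P ∈ polyFun V) : P ∈ Submodule.span ℝ (Set.range fun (m : V → ℕ) (h : V) =>
      ∏ a : σ, hσ.coord a h ^ m a) := by
  classical
  have hP' : P ∈ Subalgebra.toSubmodule (polyFun V) := hP
  rw [polyFun, Algebra.adjoin_eq_span] at hP'
  refine Submodule.span_le.2 ?_ hP'
  intro f hf
  clear hP hP'
  induction hf using Submonoid.closure_induction_left with
  | one => exact Submodule.subset_span ⟨0, by funext h; simp⟩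
  | mul_left x hx f _ ih =>
    obtain ⟨y, rfl⟩ := hx
    rw [SetLike.mem_coe] at ih ⊢
    clear * - ih
    induction ih using Submodule.span_induction with
    | mem f h =>
      obtain ⟨m, rfl⟩ := h
      have e : ((fun h : V => y h) * fun h => ∏ a : σ, hσ.coord a h ^ m a) =
          ∑ b : σ, y b • fun h => ∏ a : σ, hσ.coord a h ^ bump m b a := by
        funext h
        rw [Pi.mul_apply, Finset.sum_apply, hσ.dual_apply y h, Finset.sum_mul]
        refine Finset.sum_congr rfl fun b _ => ?_
        have h1 := prod_bump (Finset.mem_univ b) (fun a : σ => m a) fun a : σ => hσ.coord a h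
        have h2 : ∀ a : σ, bump m (b : V) (a : V) = bump (fun a : σ => m a) b a := by
          intro a
          by_cases hab : a = b
          · rw [hab, bump_self, bump_self]
          · rw [bump_of_ne _ hab, bump_of_ne _ fun h => hab (Subtype.ext h)]
        simp only [Pi.smul_apply, smul_eq_mul, h2, h1]
        ring
      rw [e]
      exact sum_mem fun b _ => Submodule.smul_mem _ _ (Submodule.subset_span ⟨_, rfl⟩)
    | zero => rw [mul_zero]; exact zero_mem _
    | add f g _ _ hf hg => rw [mul_add]; exact add_mem hf hg
    | smul c f _ hf => rw [mul_smul_comm]; exact Submodule.smul_mem _ _ hf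

/-! ### Continuity of the functions in `P_Δ(δ)` -/

theorem IsBasis.eventually_mem_cone_iff_of_mem_reg [FiniteDimensional ℝ V] {Δ σ : Finset V}
    (hσ : IsBasis Δ σ) {h : V}
    (hh : h ∈ reg Δ) : ∀ᶠ x in 𝓝 h, (x ∈ cone σ ↔ h ∈ cone σ) := by
  have key : ∀ᶠ x in 𝓝 h, ∀ a : σ, (0 ≤ hσ.coord a x ↔ 0 ≤ hσ.coord a h) := by
    refine eventually_all.2 fun a => ?_
    have ht := (hσ.coord a).continuous.tendsto h
    rcases lt_or_gt_of_ne (hσ.coord_ne_zero hh a) with h0 | h0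
    · filter_upwards [ht.eventually_lt_const h0] with x hx
      exact ⟨fun h1 => by linarith, fun h1 => by linarith⟩
    · filter_upwards [ht.eventually_const_lt h0] with x hx
      exact ⟨fun _ => h0.le, fun _ => hx.le⟩
  filter_upwards [key] with x hx
  rw [hσ.mem_cone, hσ.mem_cone]
  exact forall_congr' hx

/-- No coordinate vanishes at a regular point, so [C(σ)] is locally constant there. -/
theorem continuous_of_mem_locPoly [FiniteDimensional ℝ V] {Δ : Finset V} {δ : Set
    (StrongDual ℝ V)} {f : reg Δ → ℝ}
    (hf : f ∈ locPoly Δ δ) : Continuous f := by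
  induction hf using Submodule.span_induction with
  | mem f h =>
    obtain ⟨P, hP, σ, hσ, -, rfl⟩ := h
    refine ((polyFun_continuous hP).comp continuous_subtype_val).mul ?_
    refine continuous_iff_continuousAt.2 fun h => ?_
    have h1 : (cone σ).indicator (1 : V → ℝ) =ᶠ[𝓝 h.1]
        fun _ => (cone σ).indicator (1 : V → ℝ) h.1 := by
      filter_upwards [hσ.eventually_mem_cone_iff_of_mem_reg h.2] with x hx
      by_cases hc : h.1 ∈ cone σ
      · rw [Set.indicator_of_mem hc, Set.indicator_of_mem (hx.2 hc)]
        rfl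
      · rw [Set.indicator_of_notMem hc, Set.indicator_of_notMem fun h' => hc (hx.1 h')]
    have h2 : ContinuousAt ((cone σ).indicator (1 : V → ℝ)) h.1 :=
      continuousAt_const.congr h1.symm
    exact ContinuousAt.comp (f := Subtype.val) h2 continuous_subtype_val.continuousAt
  | zero => exact continuous_const
  | add f g _ _ hf hg => exact hf.add hg
  | smul c f _ hf => exact hf.const_smul c

/-! ### An algebra of exponentials -/

/-- The bounded continuous functions that agree on `δ^∨` with an exponential `e^{-y}`, where `y`
lies in `δ` or is zero. -/
def expMonoid {Δ : Finset V} {δ : Set (StrongDual ℝ V)} (hδ : IsDualChamber Δ δ) :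
    Submonoid (BoundedContinuousFunction V ℝ) where
  carrier := {u | ∃ y : StrongDual ℝ V, (y = 0 ∨ y ∈ δ) ∧
    ∀ h ∈ dualCone δ, u h = Real.exp (-(y h))}
  one_mem' := ⟨0, Or.inl rfl, fun h _ => by simp⟩
  mul_mem' := by
    rintro u v ⟨y, hy, hu⟩ ⟨z, hz, hv⟩
    refine ⟨y + z, ?_, fun h hh => ?_⟩
    · rcases hy with rfl | hy
      · simpa using hz
      · rcases hz with rfl | hz
        · simpa using Or.inr hy
        · exact Or.inr (hδ.add_mem hy hz)
    · rw [BoundedContinuousFunction.mul_apply, hu h hh, hv h hh, ← Real.exp_add, add_apply, neg_add]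

/-- The algebra generated by `expMonoid`. -/
def expAlgebra {Δ : Finset V} {δ : Set (StrongDual ℝ V)} (hδ : IsDualChamber Δ δ) :
    StarSubalgebra ℝ (BoundedContinuousFunction V ℝ) where
  toSubalgebra := Algebra.adjoin ℝ (expMonoid hδ : Set (BoundedContinuousFunction V ℝ))
  star_mem' := by
    intro u hu
    have : star u = u := BoundedContinuousFunction.ext fun x => by simp
    rw [this]
    exact hu

/-- Since δ is open, a form that does not separate the points can be perturbed inside δ by one that
does. -/
theorem IsDualChamber.exists_apply_ne {Δ : Finset V} {δ : Set (StrongDual ℝ V)}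
    (hδ : IsDualChamber Δ δ) {x x' : V} (hx : x ≠ x') : ∃ y ∈ δ, y x ≠ y x' := by
  obtain ⟨y₀, hy₀⟩ := hδ.nonempty
  by_cases h : y₀ x = y₀ x'
  · obtain ⟨w, hw⟩ := SeparatingDual.exists_ne_zero (R := ℝ) (sub_ne_zero.2 hx)
    have hc : Continuous fun t : ℝ => y₀ + t • w := by fun_prop
    have ht : ∀ᶠ t in 𝓝[>] (0 : ℝ), y₀ + t • w ∈ δ :=
      (hc.continuousAt.eventually_mem (by simpa using hδ.isOpen.mem_nhds hy₀)).filter_mono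
        nhdsWithin_le_nhds
    obtain ⟨t, ht, ht0⟩ := (ht.and self_mem_nhdsWithin).exists
    refine ⟨_, ht, fun h' => ?_⟩
    simp only [add_apply, smul_apply, smul_eq_mul, h, add_right_inj] at h'
    have h2 := mul_left_cancel₀ (ne_of_gt ht0) h'
    rw [map_sub, h2, sub_self] at hw
    exact hw rfl
  · exact ⟨y₀, hy₀, h⟩

/-- Points must be separated on all of V, where e^{-y} is unbounded for y ≠ 0. On δ^∨ the bounded
functions e^{-max(y,0)} and e^{-max(-y,0)} equal e^{-y} and 1, which is why the zero form is
admitted; together they determine the value of y. -/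
theorem expAlgebra_separatesPoints {Δ : Finset V} {δ : Set (StrongDual ℝ V)}
    (hδ : IsDualChamber Δ δ) :
    ((expAlgebra hδ).map (BoundedContinuousFunction.toContinuousMapStarₐ ℝ)).SeparatesPoints := by
  intro x x' hx
  obtain ⟨y, hy, hne⟩ := hδ.exists_apply_ne hx
  let u (z : StrongDual ℝ V) : BoundedContinuousFunction V ℝ :=
    BoundedContinuousFunction.ofNormedAddCommGroup (fun h => Real.exp (-(max (z h) 0)))
      (by fun_prop) 1 (fun h => by
        rw [Real.norm_eq_abs, abs_of_pos (Real.exp_pos _), Real.exp_le_one_iff]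
        simp)
  have hu1 : u y ∈ expAlgebra hδ := Algebra.subset_adjoin
    ⟨y, Or.inr hy, fun h hh => by
      change Real.exp (-(max (y h) 0)) = _
      rw [max_eq_left (hh y hy)]⟩
  have hu2 : u (-y) ∈ expAlgebra hδ := Algebra.subset_adjoin
    ⟨0, Or.inl rfl, fun h hh => by
      change Real.exp (-(max ((-y) h) 0)) = _
      rw [max_eq_right (by simpa using hh y hy)]
      simp⟩
  by_cases h1 : u y x = u y x'
  · refine ⟨_, ⟨_, ⟨u (-y), hu2, rfl⟩, rfl⟩, fun h2 => hne ?_⟩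
    have h3 : max (y x) 0 = max (y x') 0 := neg_injective (Real.exp_injective h1)
    have h4 : max (-(y x)) 0 = max (-(y x')) 0 := neg_injective (Real.exp_injective h2)
    rw [← max_zero_sub_eq_self (y x), h3, h4, max_zero_sub_eq_self]
  · exact ⟨_, ⟨_, ⟨u y, hu1, rfl⟩, rfl⟩, h1⟩

/-! ### The exponential integral in one variable -/

theorem integral_exp_neg_mul_pow {c : ℝ} (hc : 0 < c) (n : ℕ) :
    ∫ t : ℝ, Real.exp (-(c * t)) * (t ^ n / n.factorial) * (Set.Ici 0).indicator 1 t =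
      (c ^ (n + 1))⁻¹ := by
  have h1 : (fun t : ℝ => Real.exp (-(c * t)) * (t ^ n / n.factorial) *
      (Set.Ici 0).indicator 1 t) = (Set.Ici (0 : ℝ)).indicator
        fun t => Real.exp (-(c * t)) * (t ^ n / n.factorial) := by
    funext t
    by_cases ht : t ∈ Set.Ici (0 : ℝ) <;> simp [ht]
  rw [h1, integral_indicator measurableSet_Ici, integral_Ici_eq_integral_Ioi]
  have h2 := Real.integral_rpow_mul_exp_neg_mul_Ioi (a := n + 1) (by positivity) hc
  rw [Real.Gamma_nat_eq_factorial] at h2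
  have h3 : ∫ t in Set.Ioi (0 : ℝ), Real.exp (-(c * t)) * (t ^ n / n.factorial) =
      (∫ t in Set.Ioi (0 : ℝ), t ^ ((n : ℝ) + 1 - 1) * Real.exp (-(c * t))) / n.factorial := by
    rw [← integral_div]
    refine integral_congr_ae (Eventually.of_forall fun t => ?_)
    simp only [add_sub_cancel_right, Real.rpow_natCast]
    ring
  rw [h3, h2]
  have h4 : (1 / c : ℝ) ^ ((n : ℝ) + 1) = (c ^ (n + 1))⁻¹ := by
    rw [← Nat.cast_succ, Real.rpow_natCast, one_div, inv_pow]
  rw [h4]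
  have : (n.factorial : ℝ) ≠ 0 := by positivity
  field_simp

theorem integrable_exp_neg_mul_pow {c : ℝ} (hc : 0 < c) (n : ℕ) :
    Integrable fun t : ℝ =>
      Real.exp (-(c * t)) * (t ^ n / n.factorial) * (Set.Ici 0).indicator 1 t := by
  -- A function that is not integrable has integral 0 by convention, whereas this integral is
  -- positive.
  by_contra h
  have h1 := integral_exp_neg_mul_pow hc n
  rw [integral_undef h] at h1
  have : (0 : ℝ) < (c ^ (n + 1))⁻¹ := by positivity
  exact this.ne h1

/-! ### Change of variables to the coordinates of a basis -/

/-- The coordinates of a basis `σ ⊆ Δ`, as a measurable equivalence. -/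
def IsBasis.measurableEquiv [MeasurableSpace V] [BorelSpace V] {Δ σ : Finset V}
  (hσ : IsBasis Δ σ) : V ≃ᵐ (σ → ℝ) :=
  hσ.basis.equivFunL.toHomeomorph.toMeasurableEquiv

/-- The image measure is a Haar measure, hence a multiple of Lebesgue measure; the factor is read
off the unit cube, whose preimage is the parallelepiped on σ. -/
theorem IsBasis.map_measure [MeasurableSpace V] [BorelSpace V] (μ : Measure V)
    [μ.IsAddHaarMeasure] {Δ σ : Finset V} (hσ : IsBasis Δ σ) :
    0 < vol μ σ ∧
    μ.map hσ.measurableEquiv = ENNReal.ofReal (vol μ σ) • (volume : Measure (σ → ℝ)) := by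
  have hν : (μ.map hσ.measurableEquiv).IsAddHaarMeasure :=
    hσ.basis.equivFunL.isAddHaarMeasure_map μ
  let K := TopologicalSpace.PositiveCompacts.piIcc01 σ
  have h1 : (μ.map hσ.measurableEquiv) K = μ (parallelepiped fun a : σ => (a : V)) := by
    rw [MeasurableEquiv.map_apply, ← hσ.coe_basis, parallelepiped_basis_eq]
    congr 1
    ext h
    have e : (K : Set (σ → ℝ)) = Set.pi Set.univ fun _ => Set.Icc 0 1 := rfl
    rw [e]
    simp only [Set.mem_preimage, Set.mem_univ_pi]
    rfl
  have hfin : (μ.map hσ.measurableEquiv) K ≠ ⊤ := K.isCompact.measure_lt_top.ne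
  have hpos : 0 < (μ.map hσ.measurableEquiv) K :=
    Measure.measure_pos_of_nonempty_interior _ K.interior_nonempty
  have h2 := Measure.addHaarMeasure_unique (μ.map hσ.measurableEquiv) K
  rw [addHaarMeasure_eq_volume_pi] at h2
  have h3 : ENNReal.ofReal (vol μ σ) = (μ.map hσ.measurableEquiv) K := by
    rw [vol, Measure.real, ← h1, ENNReal.ofReal_toReal hfin]
  refine ⟨?_, h3 ▸ h2⟩
  rw [vol, Measure.real, ← h1]
  exact ENNReal.toReal_pos hpos.ne' hfin

section Laplace

variable [MeasurableSpace V] (μ : Measure V)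

theorem laplace_smul (Δ : Finset V) (c : ℝ) (f : reg Δ → ℝ) (y : StrongDual ℝ V) :
    laplace μ Δ (c • f) y = c * laplace μ Δ f y := by
  rw [laplace, laplace, ← integral_const_mul]
  refine integral_congr_ae (Eventually.of_forall fun x => ?_)
  simp only [Pi.smul_apply, smul_eq_mul]
  ring

variable [FiniteDimensional ℝ V]

/-- The function on `V` whose Laplace transform is `1 / ∏_{a ∈ σ} a ^ (m a + 1)`. -/
def IsBasis.expPoly {Δ σ : Finset V} (hσ : IsBasis Δ σ) (m : V → ℕ) (h : V) : ℝ :=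
  (vol μ σ)⁻¹ * (∏ a : σ, hσ.coord a h ^ m a / (m a).factorial) * (cone σ).indicator 1 h

theorem IsBasis.expPoly_poly_mem {Δ σ : Finset V} (hσ : IsBasis Δ σ) (m : V → ℕ) :
    (fun h => (vol μ σ)⁻¹ * ∏ a : σ, hσ.coord a h ^ m a / (m a).factorial) ∈ polyFun V := by
  have e : (fun h => (vol μ σ)⁻¹ * ∏ a : σ, hσ.coord a h ^ m a / (m a).factorial) =
      ((vol μ σ)⁻¹ * ∏ a : σ, ((m a).factorial : ℝ)⁻¹) •
        ∏ a : σ, (fun h => hσ.coord a h) ^ m a := by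
    funext h
    simp only [Pi.smul_apply, Finset.prod_apply, Pi.pow_apply, smul_eq_mul, div_eq_mul_inv,
      Finset.prod_mul_distrib]
    ring
  rw [e]
  exact Subalgebra.smul_mem _ (prod_mem fun a _ => pow_mem (dual_mem_polyFun _) _) _

variable [BorelSpace V]

theorem IsBasis.measurableEquiv_apply {Δ σ : Finset V} (hσ : IsBasis Δ σ) (h : V) (a : σ) :
    hσ.measurableEquiv h a = hσ.coord a h := rfl

theorem IsBasis.exp_mul_expPoly {Δ σ : Finset V} (hσ : IsBasis Δ σ) (m : V → ℕ)
    (y : StrongDual ℝ V) :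
    (fun h => Real.exp (-(y h)) * hσ.expPoly μ m h) = fun h => (vol μ σ)⁻¹ *
      (fun x : σ → ℝ => ∏ a : σ, Real.exp (-(y a * x a)) * (x a ^ m a / (m a).factorial) *
        (Set.Ici 0).indicator 1 (x a)) (hσ.measurableEquiv h) := by
  funext h
  simp only [IsBasis.expPoly, hσ.mem_cone_iff_indicator, IsBasis.measurableEquiv_apply,
    Finset.prod_mul_distrib]
  rw [hσ.dual_apply y h, ← Finset.sum_neg_distrib, Real.exp_sum]
  ring

variable [μ.IsAddHaarMeasure]

theorem IsBasis.integrable_exp_mul_expPoly {Δ σ : Finset V} (hσ : IsBasis Δ σ) (m : V → ℕ)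
    {y : StrongDual ℝ V} (hy : ∀ a ∈ σ, 0 < y a) :
    Integrable (fun h => Real.exp (-(y h)) * hσ.expPoly μ m h) μ := by
  rw [hσ.exp_mul_expPoly μ m y]
  refine Integrable.const_mul ?_ _
  refine (integrable_map_equiv hσ.measurableEquiv (fun x : σ → ℝ => ∏ a : σ,
    Real.exp (-(y a * x a)) * (x a ^ m a / (m a).factorial) *
      (Set.Ici 0).indicator 1 (x a))).1 ?_
  rw [(hσ.map_measure μ).2]
  refine Integrable.smul_measure ?_ ENNReal.ofReal_ne_top
  exact Integrable.fintype_prod (f := fun (a : σ) (t : ℝ) => Real.exp (-(y a * t)) *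
    (t ^ m a / (m a).factorial) * (Set.Ici 0).indicator 1 t)
    fun a => integrable_exp_neg_mul_pow (hy a a.2) (m a)

theorem IsBasis.integral_exp_mul_expPoly {Δ σ : Finset V} (hσ : IsBasis Δ σ) (m : V → ℕ)
    {y : StrongDual ℝ V} (hy : ∀ a ∈ σ, 0 < y a) :
    ∫ h, Real.exp (-(y h)) * hσ.expPoly μ m h ∂μ = (∏ a ∈ σ, y a ^ (m a + 1))⁻¹ := by
  obtain ⟨hv, hmap⟩ := hσ.map_measure μ
  rw [hσ.exp_mul_expPoly μ m y, integral_const_mul, ← integral_map_equiv hσ.measurableEquiv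
    (fun x : σ → ℝ => ∏ a : σ, Real.exp (-(y a * x a)) * (x a ^ m a / (m a).factorial) *
        (Set.Ici 0).indicator 1 (x a)), hmap, integral_smul_measure,
    ENNReal.toReal_ofReal hv.le, smul_eq_mul, ← mul_assoc, inv_mul_cancel₀ hv.ne', one_mul]
  have h1 := integral_fintype_prod_eq_prod (𝕜 := ℝ) (μ := fun _ : σ => (volume : Measure ℝ))
    (fun (a : σ) (t : ℝ) => Real.exp (-(y a * t)) *
      (t ^ m a / (m a).factorial) * (Set.Ici 0).indicator 1 t)
  rw [volume_pi, h1, ← Finset.prod_inv_distrib, ← Finset.prod_coe_sort σ]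
  exact Finset.prod_congr rfl fun a _ => integral_exp_neg_mul_pow (hy a a.2) (m a)

theorem laplace_restrict (Δ : Finset V) (F : V → ℝ) (y : StrongDual ℝ V) :
    laplace μ Δ (fun h : reg Δ => F h.1) y = ∫ h, Real.exp (-(y h)) * F h ∂μ := by
  rw [laplace, integral_subtype_comap (isOpen_reg Δ).measurableSet
    (fun h => Real.exp (-(y h)) * F h), Measure.restrict_eq_self_of_ae_mem]
  rw [ae_iff]
  exact measure_compl_reg μ Δ

/-! ### Functions in `P_Δ(δ)` -/

theorem locPoly_eq_span (Δ : Finset V) (δ : Set (StrongDual ℝ V)) :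
    locPoly Δ δ = Submodule.span ℝ {f | ∃ (σ : Finset V) (hσ : IsBasis Δ σ)
      (_ : cone σ ⊆ dualCone δ) (m : V → ℕ), f = fun h : reg Δ => hσ.expPoly μ m h.1} := by
  refine le_antisymm (Submodule.span_le.2 ?_) (Submodule.span_mono ?_)
  · rintro f ⟨P, hP, σ, hσ, hσδ, rfl⟩
    have hP' := hσ.polyFun_mem_span hP
    rw [SetLike.mem_coe]
    clear hP
    induction hP' using Submodule.span_induction with
    | mem P h =>
      obtain ⟨m, rfl⟩ := h
      have e : (fun h : reg Δ => (∏ a : σ, hσ.coord a h.1 ^ m a) * (cone σ).indicator 1 h.1) =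
          (vol μ σ * ∏ a : σ, ((m a).factorial : ℝ)) • fun h : reg Δ => hσ.expPoly μ m h.1 := by
        funext h
        have h1 := (hσ.map_measure μ).1.ne'
        have h2 : (∏ a : σ, ((m a).factorial : ℝ)) ≠ 0 :=
          Finset.prod_ne_zero_iff.2 fun a _ => by positivity
        simp only [Pi.smul_apply, smul_eq_mul, IsBasis.expPoly, Finset.prod_div_distrib]
        field_simp
      rw [e]
      exact Submodule.smul_mem _ _ (Submodule.subset_span ⟨σ, hσ, hσδ, m, rfl⟩)
    | zero => simp only [Pi.zero_apply, zero_mul]; exact zero_mem _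
    | add f g _ _ hf hg =>
      simp only [Pi.add_apply, add_mul]
      exact add_mem hf hg
    | smul c f _ hf =>
      simp only [Pi.smul_apply, smul_eq_mul, mul_assoc]
      exact Submodule.smul_mem _ c hf
  · rintro f ⟨σ, hσ, hσδ, m, rfl⟩
    exact ⟨_, hσ.expPoly_poly_mem μ m, σ, hσ, hσδ, rfl⟩

/-- Supplies what injectivity needs: a representative on V with support in δ^∨ and convergent
integrals on δ. -/
theorem exists_extension_of_mem_locPoly {Δ : Finset V} {δ : Set (StrongDual ℝ V)}
    (hδ : IsDualChamber Δ δ) {f : reg Δ → ℝ} (hf : f ∈ locPoly Δ δ) :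
    ∃ F : V → ℝ, f = (fun h : reg Δ => F h.1) ∧ (∀ h ∉ dualCone δ, F h = 0) ∧
      ∀ y ∈ δ, Integrable (fun h => Real.exp (-(y h)) * F h) μ := by
  rw [locPoly_eq_span μ] at hf
  induction hf using Submodule.span_induction with
  | mem f h =>
    obtain ⟨σ, hσ, hσδ, m, rfl⟩ := h
    refine ⟨hσ.expPoly μ m, rfl, fun h hh => ?_, fun y hy => ?_⟩
    · rw [IsBasis.expPoly, Set.indicator_of_notMem fun h' => hh (hσδ h'), mul_zero]
    · exact hσ.integrable_exp_mul_expPoly μ m ((hδ.cone_subset_iff hy hσ.1.1).1 hσδ)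
  | zero => exact ⟨0, rfl, fun _ _ => rfl, fun y _ => by simp⟩
  | add f g _ _ hf hg =>
    obtain ⟨F, rfl, hF0, hF⟩ := hf
    obtain ⟨K, rfl, hK0, hK⟩ := hg
    refine ⟨F + K, rfl, fun h hh => ?_, fun y hy => ?_⟩
    · rw [Pi.add_apply, hF0 h hh, hK0 h hh, add_zero]
    · simp only [Pi.add_apply, mul_add]
      exact (hF y hy).add (hK y hy)
  | smul c f _ hf =>
    obtain ⟨F, rfl, hF0, hF⟩ := hf
    refine ⟨c • F, rfl, fun h hh => ?_, fun y hy => ?_⟩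
    · rw [Pi.smul_apply, hF0 h hh, smul_zero]
    · simp only [Pi.smul_apply, smul_eq_mul, mul_left_comm _ c]
      exact (hF y hy).const_mul c

theorem laplace_add {Δ : Finset V} {δ : Set (StrongDual ℝ V)} (hδ : IsDualChamber Δ δ)
    {f g : reg Δ → ℝ} (hf : f ∈ locPoly Δ δ) (hg : g ∈ locPoly Δ δ) {y : StrongDual ℝ V}
    (hy : y ∈ δ) : laplace μ Δ (f + g) y = laplace μ Δ f y + laplace μ Δ g y := by
  obtain ⟨F, rfl, -, hF⟩ := exists_extension_of_mem_locPoly μ hδ hf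
  obtain ⟨K, rfl, -, hK⟩ := exists_extension_of_mem_locPoly μ hδ hg
  have h := laplace_restrict μ Δ (F + K) y
  rw [laplace_restrict, laplace_restrict, ← integral_add (hF y hy) (hK y hy)]
  refine h.trans (integral_congr_ae (Eventually.of_forall fun x => ?_))
  simp [mul_add]

/-! ### Injectivity of the Laplace transform -/

/-- The positive and negative parts of g are densities of two finite measures with equal integrals
against A. A point-separating algebra of bounded continuous functions determines a finite measure on
V, so the two parts coincide. -/
theorem eq_zero_ae_of_integral_mul_eq_zero {g : V → ℝ} (hg : Integrable g μ)
    {A : StarSubalgebra ℝ (BoundedContinuousFunction V ℝ)}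
    (hA : (A.map (BoundedContinuousFunction.toContinuousMapStarₐ ℝ)).SeparatesPoints)
    (h : ∀ u ∈ A, ∫ x, g x * u x ∂μ = 0) : g =ᵐ[μ] 0 := by
  have : ProperSpace V := FiniteDimensional.proper ℝ V
  have : CompleteSpace V := FiniteDimensional.complete ℝ V
  have h1 := isFiniteMeasure_withDensity_ofReal hg.2
  have h2 := isFiniteMeasure_withDensity_ofReal hg.neg.2
  have hm1 : AEMeasurable (fun x => ENNReal.ofReal (g x)) μ := hg.1.aemeasurable.ennreal_ofReal
  have hm2 : AEMeasurable (fun x => ENNReal.ofReal ((-g) x)) μ :=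
    hg.neg.1.aemeasurable.ennreal_ofReal
  have key := ext_of_forall_mem_subalgebra_integral_eq_of_pseudoEMetric_complete_countable
    (P := μ.withDensity fun x => ENNReal.ofReal (g x))
    (P' := μ.withDensity fun x => ENNReal.ofReal ((-g) x)) hA (by
      intro u hu
      rw [integral_withDensity_eq_integral_toReal_smul₀ hm1 (by simp),
        integral_withDensity_eq_integral_toReal_smul₀ hm2 (by simp), ← sub_eq_zero]
      have hb : ∀ f : V → ℝ, Integrable f μ → Integrable (fun x => f x * u x) μ := by
        intro f hf
        have := hf.bdd_mul (f := u) (c := ‖u‖) u.continuous.aestronglyMeasurable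
          (Eventually.of_forall u.norm_coe_le_norm)
        simpa only [mul_comm] using this
      simp only [ENNReal.toReal_ofReal', smul_eq_mul]
      rw [← integral_sub (hb _ hg.pos_part) (hb _ hg.neg.pos_part)]
      refine Eq.trans ?_ (h u hu)
      refine integral_congr_ae (Eventually.of_forall fun x => ?_)
      simp only [Pi.neg_apply]
      rw [← sub_mul, max_zero_sub_eq_self])
  have h3 := (withDensity_eq_iff_of_sigmaFinite hm1 hm2).1 key
  filter_upwards [h3] with x hx
  have h4 := congrArg ENNReal.toReal hx
  rw [ENNReal.toReal_ofReal', ENNReal.toReal_ofReal', Pi.neg_apply] at h4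
  rw [Pi.zero_apply, ← max_zero_sub_eq_self (g x), h4, sub_self]

/-- The integrable function e^{-y₀}F, paired with e^{-y}, gives the transform of F at y₀ + y. This
point is again in δ, as δ is closed under addition. -/
theorem eq_zero_ae_of_laplace_eq_zero {Δ : Finset V} {δ : Set (StrongDual ℝ V)}
    (hδ : IsDualChamber Δ δ) {F : V → ℝ} (h0 : ∀ h ∉ dualCone δ, F h = 0)
    (hint : ∀ y ∈ δ, Integrable (fun h => Real.exp (-(y h)) * F h) μ)
    (hzero : ∀ y ∈ δ, ∫ h, Real.exp (-(y h)) * F h ∂μ = 0) : F =ᵐ[μ] 0 := by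
  obtain ⟨y₀, hy₀⟩ := hδ.nonempty
  have key : (fun h => Real.exp (-(y₀ h)) * F h) =ᵐ[μ] 0 := by
    refine eq_zero_ae_of_integral_mul_eq_zero μ (hint y₀ hy₀) (expAlgebra_separatesPoints hδ) ?_
    intro u hu
    have hu' : u ∈ Subalgebra.toSubmodule (Algebra.adjoin ℝ
      (expMonoid hδ : Set (BoundedContinuousFunction V ℝ))) := hu
    rw [Algebra.adjoin_eq_span, Submonoid.closure_eq] at hu'
    have hb : ∀ u : BoundedContinuousFunction V ℝ,
        Integrable (fun h => Real.exp (-(y₀ h)) * F h * u h) μ := by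
      intro u
      have := (hint y₀ hy₀).bdd_mul (f := u) (c := ‖u‖) u.continuous.aestronglyMeasurable
        (Eventually.of_forall u.norm_coe_le_norm)
      simpa only [mul_comm] using this
    clear hu
    induction hu' using Submodule.span_induction with
    | mem u h =>
      obtain ⟨y, hy, hu⟩ := h
      have hmem : y₀ + y ∈ δ := by
        rcases hy with rfl | hy
        · simpa using hy₀
        · exact hδ.add_mem hy₀ hy
      rw [← hzero _ hmem]
      refine integral_congr_ae (Eventually.of_forall fun h => ?_)
      -- Off δ^∨ nothing is known about u, but there F vanishes.
      by_cases hh : h ∈ dualCone δ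
      · simp only [hu h hh, add_apply, neg_add, Real.exp_add]
        ring
      · simp [h0 h hh]
    | zero => simp
    | add u v _ _ hu hv =>
      simp only [BoundedContinuousFunction.add_apply, mul_add]
      rw [integral_add (hb u) (hb v), hu, hv, add_zero]
    | smul c u _ hu =>
      simp only [BoundedContinuousFunction.coe_smul, smul_eq_mul, mul_left_comm _ c]
      rw [integral_const_mul, hu, mul_zero]
  filter_upwards [key] with h hh
  exact (mul_eq_zero.1 hh).resolve_left (Real.exp_pos _).ne'

/-- A Haar measure charges nonempty open sets, so a function continuous on V_reg and zero almost
everywhere is zero on V_reg. -/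
theorem eq_zero_of_mem_locPoly_of_ae {Δ : Finset V} {δ : Set (StrongDual ℝ V)} {f : reg Δ → ℝ}
    (hf : f ∈ locPoly Δ δ) {F : V → ℝ} (hF : ∀ h : reg Δ, F h.1 = f h) (h0 : F =ᵐ[μ] 0) :
    f = 0 := by
  have hc : ContinuousOn F (reg Δ) := by
    rw [continuousOn_iff_continuous_domRestrict]
    have : (reg Δ).domRestrict F = f := funext hF
    rw [this]
    exact continuous_of_mem_locPoly hf
  have := Measure.eqOn_open_of_ae_eq (ae_restrict_of_ae h0) (isOpen_reg Δ) hc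
    continuousOn_const
  funext h
  rw [← hF h]
  exact this h.2

theorem eq_zero_of_laplace_eq_zero {Δ : Finset V} {δ : Set (StrongDual ℝ V)}
    (hδ : IsDualChamber Δ δ) {f : reg Δ → ℝ} (hf : f ∈ locPoly Δ δ)
    (h : ∀ y ∈ δ, laplace μ Δ f y = 0) : f = 0 := by
  obtain ⟨F, hF, hF0, hint⟩ := exists_extension_of_mem_locPoly μ hδ hf
  refine eq_zero_of_mem_locPoly_of_ae μ hf (F := F) (fun h => by rw [hF]) ?_
  refine eq_zero_ae_of_laplace_eq_zero μ hδ hF0 hint fun y hy => ?_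
  rw [← laplace_restrict μ Δ, ← hF]
  exact h y hy

end Laplace

end StratifiedFourier

end

/-! ### Boundary values along γ, and the transforms F_δ and F_{γ,δ}. -/

noncomputable section

namespace StratifiedFourier

variable {V : Type*} [NormedAddCommGroup V] [NormedSpace ℝ V]

/-! ### Limits along the direction of a chamber -/

/-- `g` is the limit of `f` along `ε p`, `ε → 0⁺`, at every point of `V`. -/
def IsLimitAlong {Δ : Finset V} (p : V) (f : reg Δ → ℝ) (g : V → ℝ) : Prop :=
  ∀ h : V, Tendsto (fun ε : ℝ => extendZero f (h + ε • p)) (𝓝[>] 0) (𝓝 (g h))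

theorem IsLimitAlong.unique {Δ : Finset V} {p : V} {f : reg Δ → ℝ} {g g' : V → ℝ}
    (h : IsLimitAlong p f g) (h' : IsLimitAlong p f g') : g = g' :=
  funext fun x => tendsto_nhds_unique (h x) (h' x)

theorem IsLimitAlong.add {Δ : Finset V} {p : V} {f f' : reg Δ → ℝ} {g g' : V → ℝ}
    (h : IsLimitAlong p f g) (h' : IsLimitAlong p f' g') : IsLimitAlong p (f + f') (g + g') := by
  intro x
  rw [extendZero_add]
  exact (h x).add (h' x)

theorem IsLimitAlong.zero {Δ : Finset V} (p : V) : IsLimitAlong p (0 : reg Δ → ℝ) 0 := by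
  intro h
  have : extendZero (0 : reg Δ → ℝ) = 0 := by
    funext x
    by_cases hx : x ∈ reg Δ
    · rw [extendZero_apply _ ⟨x, hx⟩]
      rfl
    · simp [extendZero, Function.extend_apply', hx]
  rw [this]
  exact tendsto_const_nhds

theorem tendsto_add_smul (p h : V) : Tendsto (fun ε : ℝ => h + ε • p) (𝓝[>] 0) (𝓝 h) := by
  have hc : Continuous fun ε : ℝ => h + ε • p := by fun_prop
  have := hc.tendsto 0
  rw [zero_smul, add_zero] at this
  exact this.mono_left nhdsWithin_le_nhds

theorem IsLimitAlong.continuous_mul {Δ : Finset V} {p : V} (hp : p ∈ reg Δ) {f : reg Δ → ℝ}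
    {g q : V → ℝ} (hq : Continuous q) (h : IsLimitAlong p f g) :
    IsLimitAlong p (fun x : reg Δ => q x.1 * f x) fun x => q x * g x := by
  intro x
  refine Tendsto.congr' ?_ (((hq.tendsto x).comp (tendsto_add_smul p x)).mul (h x))
  filter_upwards [eventually_add_smul_mem_reg Δ hp x] with ε hε
  rw [extendZero_apply f ⟨_, hε⟩, extendZero_apply _ ⟨_, hε⟩]
  rfl

theorem IsLimitAlong.smul {Δ : Finset V} {p : V} (hp : p ∈ reg Δ) {f : reg Δ → ℝ}
    {g : V → ℝ} (c : ℝ) (h : IsLimitAlong p f g) : IsLimitAlong p (c • f) (c • g) :=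
  h.continuous_mul hp (q := fun _ => c) continuous_const

theorem isLimitAlong_of_continuous {Δ : Finset V} {p : V} (hp : p ∈ reg Δ) {f : reg Δ → ℝ}
    {g : V → ℝ} (hg : Continuous g) (h : ∀ x : reg Δ, g x.1 = f x) : IsLimitAlong p f g := by
  intro x
  refine Tendsto.congr' ?_ ((hg.tendsto x).comp (tendsto_add_smul p x))
  filter_upwards [eventually_add_smul_mem_reg Δ hp x] with ε hε
  rw [extendZero_apply f ⟨_, hε⟩, ← h]
  rfl

variable [FiniteDimensional ℝ V]

theorem IsBasis.isLimitAlong_indicator {Δ σ : Finset V} (hσ : IsBasis Δ σ) {γ : Set V}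
    (hγ : IsChamber Δ γ) {p : V} (hp : p ∈ γ) :
    IsLimitAlong p (fun x : reg Δ => (cone σ).indicator (1 : V → ℝ) x.1)
      ((shiftedCone γ σ).indicator 1) := by
  intro h
  refine Tendsto.congr' ?_ tendsto_const_nhds
  filter_upwards [hσ.eventually_mem_cone_iff hγ hp h,
    eventually_add_smul_mem_reg Δ (hγ.subset_reg hp) h] with ε hε hr
  rw [extendZero_apply _ ⟨_, hr⟩]
  by_cases hc : h ∈ shiftedCone γ σ
  · rw [Set.indicator_of_mem hc, Set.indicator_of_mem (hε.2 hc)]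
    rfl
  · rw [Set.indicator_of_notMem hc, Set.indicator_of_notMem fun h' => hc (hε.1 h')]

/-- On generators, P [C(σ)] has the limit P [C(σ)'_γ]. -/
theorem exists_isLimitAlong {Δ : Finset V} {γ : Set V} (hγ : IsChamber Δ γ) {p : V} (hp : p ∈ γ)
    {δ : Set (StrongDual ℝ V)} {f : reg Δ → ℝ} (hf : f ∈ locPoly Δ δ) :
    ∃ g ∈ piecePoly Δ, IsLimitAlong p f g := by
  have hpr := hγ.subset_reg hp
  induction hf using Submodule.span_induction with
  | mem f h =>
    obtain ⟨P, hP, σ, hσ, -, rfl⟩ := h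
    exact ⟨_, hσ.shiftedCone_mem_piecePoly hγ hp hP,
      (hσ.isLimitAlong_indicator hγ hp).continuous_mul hpr (polyFun_continuous hP)⟩
  | zero => exact ⟨0, zero_mem _, IsLimitAlong.zero p⟩
  | add f f' _ _ hf hf' =>
    obtain ⟨g, hg, h⟩ := hf
    obtain ⟨g', hg', h'⟩ := hf'
    exact ⟨g + g', add_mem hg hg', h.add h'⟩
  | smul c f _ hf =>
    obtain ⟨g, hg, h⟩ := hf
    exact ⟨c • g, Submodule.smul_mem _ c hg, h.smul hpr c⟩

theorem IsLimitAlong.eq_of_continuous {Δ : Finset V} {p : V} {f : reg Δ → ℝ} {g : V → ℝ}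
    (hf : Continuous f) (h : IsLimitAlong p f g) (x : reg Δ) : g x.1 = f x := by
  have hc : ContinuousOn (extendZero f) (reg Δ) := by
    rw [continuousOn_iff_continuous_domRestrict]
    have : (reg Δ).domRestrict (extendZero f) = f := funext (extendZero_apply f)
    rwa [this]
  have h1 := (hc.continuousAt ((isOpen_reg Δ).mem_nhds x.2)).tendsto.comp (tendsto_add_smul p x.1)
  rw [extendZero_apply] at h1
  exact tendsto_nhds_unique (h x.1) h1

/-! ### The inverse Laplace transform -/

section Fourier

variable [MeasurableSpace V] [BorelSpace V] (μ : Measure V) [μ.IsAddHaarMeasure]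
  {Δ : Finset V} {δ : Set (StrongDual ℝ V)} (hδ : IsDualChamber Δ δ)

include hδ

variable {μ}

theorem IsInverseLaplace.add {φ ψ : ratRing Δ} {f g : reg Δ → ℝ}
    (hf : IsInverseLaplace μ Δ δ φ f) (hg : IsInverseLaplace μ Δ δ ψ g) :
    IsInverseLaplace μ Δ δ (φ + ψ) (f + g) :=
  ⟨add_mem hf.1 hg.1, fun y hy => by
    rw [laplace_add μ hδ hf.1 hg.1 hy, hf.2 y hy, hg.2 y hy]
    rfl⟩

omit [FiniteDimensional ℝ V] [BorelSpace V] [μ.IsAddHaarMeasure] hδ in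
theorem IsInverseLaplace.smul {φ : ratRing Δ} {f : reg Δ → ℝ} (c : ℝ)
    (hf : IsInverseLaplace μ Δ δ φ f) : IsInverseLaplace μ Δ δ (c • φ) (c • f) :=
  ⟨Submodule.smul_mem _ c hf.1, fun y hy => by
    rw [laplace_smul, hf.2 y hy]
    rfl⟩

omit [FiniteDimensional ℝ V] [BorelSpace V] [μ.IsAddHaarMeasure] hδ in
theorem IsInverseLaplace.zero : IsInverseLaplace μ Δ δ 0 0 :=
  ⟨zero_mem _, fun y _ => by
    simp only [laplace, Pi.zero_apply, mul_zero, integral_zero]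
    rfl⟩

theorem IsInverseLaplace.sum {ι : Type*} (s : Finset ι) {φ : ι → ratRing Δ} {f : ι → reg Δ → ℝ}
    (h : ∀ i ∈ s, IsInverseLaplace μ Δ δ (φ i) (f i)) :
    IsInverseLaplace μ Δ δ (∑ i ∈ s, φ i) (∑ i ∈ s, f i) := by
  classical
  induction s using Finset.induction_on with
  | empty => exact IsInverseLaplace.zero
  | insert a s ha ih =>
    rw [Finset.sum_insert ha, Finset.sum_insert ha]
    exact (h a (Finset.mem_insert_self a s)).add hδ
      (ih fun i hi => h i (Finset.mem_insert_of_mem hi))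

theorem IsInverseLaplace.unique {φ : ratRing Δ} {f g : reg Δ → ℝ}
    (hf : IsInverseLaplace μ Δ δ φ f) (hg : IsInverseLaplace μ Δ δ φ g) : f = g := by
  have h := hf.add hδ (hg.smul (-1))
  have h0 : f + (-1 : ℝ) • g = 0 := by
    refine eq_zero_of_laplace_eq_zero μ hδ h.1 fun y hy => ?_
    have := h.2 ⟨y, hδ.subset_dualReg hy⟩ hy
    rw [this, neg_one_smul, add_neg_cancel]
    rfl
  rwa [neg_one_smul, ← sub_eq_add_neg, sub_eq_zero] at h0

variable (μ)

theorem IsBasis.isInverseLaplace_frac {σ : Finset V} (hσ : IsBasis Δ σ)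
    (hσδ : cone σ ⊆ dualCone δ) (m : V → ℕ) :
    IsInverseLaplace μ Δ δ (hσ.frac m) fun h => hσ.expPoly μ m h.1 := by
  refine ⟨?_, fun y hy => ?_⟩
  · rw [locPoly_eq_span μ]
    exact Submodule.subset_span ⟨σ, hσ, hσδ, m, rfl⟩
  · rw [laplace_restrict, hσ.integral_exp_mul_expPoly μ m ((hδ.cone_subset_iff hy hσ.1.1).1 hσδ),
      IsBasis.frac, invProd_apply]

omit hδ [BorelSpace V] [μ.IsAddHaarMeasure] in
-- Raising the exponent at a multiplies the density by the coordinate at a divided by m_a + 1, so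
-- the sum is the expansion of w in coordinates. It mirrors `IsBasis.dirDerivation_frac`.
theorem IsBasis.sum_expPoly_bump {σ : Finset V} (hσ : IsBasis Δ σ) (w : StrongDual ℝ V)
    (m : V → ℕ) (h : V) :
    ∑ a ∈ σ, -(((m a : ℝ) + 1) * w a) * hσ.expPoly μ (bump m a) h =
      -(w h) * hσ.expPoly μ m h := by
  rw [hσ.dual_apply w h, ← Finset.sum_coe_sort σ, ← Finset.sum_neg_distrib, Finset.sum_mul]
  refine Finset.sum_congr rfl fun b _ => ?_
  classical
  simp only [IsBasis.expPoly]
  have h1 : ∏ a : σ, hσ.coord a h ^ bump m b a / (bump m (b : V) a).factorial =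
      (∏ a : σ, hσ.coord a h ^ m a / (m a).factorial) * (hσ.coord b h / (m b + 1)) := by
    rw [← Finset.mul_prod_erase _ _ (Finset.mem_univ b),
      ← Finset.mul_prod_erase _ (fun a : σ => hσ.coord a h ^ m a / (m a).factorial)
        (Finset.mem_univ b), bump_self, Nat.factorial_succ, pow_succ]
    have h2 : ∏ a ∈ Finset.univ.erase b, hσ.coord a h ^ bump m b a / (bump m (b : V) a).factorial =
        ∏ a ∈ Finset.univ.erase b, hσ.coord a h ^ m a / (m a).factorial :=
      Finset.prod_congr rfl fun a ha => by
        rw [bump_of_ne _ fun h => Finset.ne_of_mem_erase ha (Subtype.ext h)]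
    rw [h2]
    push_cast
    field_simp
  rw [h1]
  have : (m b : ℝ) + 1 ≠ 0 := by positivity
  field_simp

/-- Existence and the derivative rule are proved together, so that the same f serves for every w as
one passes to linear combinations. -/
theorem exists_isInverseLaplace_dirDerivation {y : StrongDual ℝ V} (hy : y ∈ δ)
    {φ : ratRing Δ} (hφ : φ ∈ posFracSpan Δ y) :
    ∃ f, IsInverseLaplace μ Δ δ φ f ∧ ∀ w : StrongDual ℝ V,
      IsInverseLaplace μ Δ δ (dirDerivation Δ w φ) fun h => -(w h.1) * f h := by
  induction hφ using Submodule.span_induction with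
  | mem φ h =>
    obtain ⟨σ, hσ, hσy, m, rfl⟩ := h
    have hσδ := (hδ.cone_subset_iff hy hσ.1.1).2 hσy
    refine ⟨_, hσ.isInverseLaplace_frac μ hδ hσδ m, fun w => ?_⟩
    have h := IsInverseLaplace.sum hδ σ fun a _ =>
      (hσ.isInverseLaplace_frac μ hδ hσδ (bump m a)).smul (-(((m a : ℝ) + 1) * w a))
    rw [hσ.dirDerivation_frac]
    convert h using 1
    funext x
    rw [Finset.sum_apply, ← hσ.sum_expPoly_bump]
    rfl
  | zero =>
    refine ⟨0, IsInverseLaplace.zero, fun w => ?_⟩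
    simp only [map_zero, Pi.zero_apply, mul_zero]
    exact IsInverseLaplace.zero
  | add φ ψ _ _ hφ hψ =>
    obtain ⟨f, hf, hf'⟩ := hφ
    obtain ⟨g, hg, hg'⟩ := hψ
    refine ⟨f + g, hf.add hδ hg, fun w => ?_⟩
    simp only [map_add, Pi.add_apply, mul_add]
    exact (hf' w).add hδ (hg' w)
  | smul c φ _ hφ =>
    obtain ⟨f, hf, hf'⟩ := hφ
    refine ⟨c • f, hf.smul c, fun w => ?_⟩
    simp only [Derivation.map_smul, Pi.smul_apply, smul_eq_mul, mul_left_comm _ c]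
    exact (hf' w).smul c

theorem existsUnique_isInverseLaplace (hneg : ∀ α ∈ Δ, -α ∈ Δ) {φ : ratRing Δ} (hφ : φ ∈ G Δ) :
    ∃! f : reg Δ → ℝ, IsInverseLaplace μ Δ δ φ f := by
  obtain ⟨y, hy⟩ := hδ.nonempty
  rw [G_eq_posFracSpan hneg (hδ.subset_dualReg hy)] at hφ
  obtain ⟨f, hf, -⟩ := exists_isInverseLaplace_dirDerivation μ hδ hy hφ
  exact ⟨f, hf, fun g hg => hg.unique hδ hf⟩

theorem isInverseLaplace_inverseLaplace (hneg : ∀ α ∈ Δ, -α ∈ Δ) {φ : ratRing Δ} (hφ : φ ∈ G Δ) :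
    IsInverseLaplace μ Δ δ φ (inverseLaplace μ Δ δ φ) :=
  Classical.epsilon_spec (existsUnique_isInverseLaplace μ hδ hneg hφ).exists

variable {μ}

theorem IsInverseLaplace.dirDerivation {y : StrongDual ℝ V} (hy : y ∈ δ) {φ : ratRing Δ}
    (hφ : φ ∈ posFracSpan Δ y) {f : reg Δ → ℝ} (hf : IsInverseLaplace μ Δ δ φ f)
    (w : StrongDual ℝ V) :
    IsInverseLaplace μ Δ δ (dirDerivation Δ w φ) fun h => -(w h.1) * f h := by
  obtain ⟨g, hg, hg'⟩ := exists_isInverseLaplace_dirDerivation μ hδ hy hφ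
  rw [hf.unique hδ hg]
  exact hg' w

/-! ### `G_Δ` and `NG_Δ` meet in the kernel of the inverse Laplace transform -/

/-- The multiplier q is a product of forms -w with w ≠ 0, so its zeros lie in finitely many
hyperplanes. -/
theorem exists_isInverseLaplace_derivMonoid {y : StrongDual ℝ V} (hy : y ∈ δ)
    {A : Module.End ℝ (ratRing Δ)} (hA : A ∈ derivMonoid Δ) :
    ∃ q : V → ℝ, (∀ᵐ h ∂μ, q h ≠ 0) ∧ ∀ φ ∈ posFracSpan Δ y, ∀ f, IsInverseLaplace μ Δ δ φ f →
      A φ ∈ posFracSpan Δ y ∧ IsInverseLaplace μ Δ δ (A φ) fun h => q h.1 * f h := by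
  induction hA using Submonoid.closure_induction with
  | mem A h =>
    obtain ⟨w, hw, rfl⟩ := h
    refine ⟨fun h => -(w h), ?_, fun φ hφ f hf =>
      ⟨dirDerivation_mem_posFracSpan w hφ, hf.dirDerivation hδ hy hφ w⟩⟩
    have h1 := μ.addHaar_submodule w.toLinearMap.ker (by
      rw [Ne, LinearMap.ker_eq_top]
      exact fun h => hw (ContinuousLinearMap.coe_injective h))
    rw [ae_iff]
    refine Eq.trans (congrArg μ (Set.ext fun h => ?_)) h1
    simp
  | one =>
    refine ⟨fun _ => 1, by simp, fun φ hφ f hf => ⟨hφ, ?_⟩⟩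
    simpa using hf
  | mul A B _ _ hA hB =>
    obtain ⟨q, hq, hA⟩ := hA
    obtain ⟨r, hr, hB⟩ := hB
    refine ⟨fun h => q h * r h, ?_, fun φ hφ f hf => ?_⟩
    · filter_upwards [hq, hr] with h h1 h2
      exact mul_ne_zero h1 h2
    · obtain ⟨h1, h2⟩ := hB φ hφ f hf
      obtain ⟨h3, h4⟩ := hA _ h1 _ h2
      simp only [mul_assoc]
      exact ⟨h3, h4⟩

/-- An operator that kills φ gives q f = 0 on V_reg with q nonzero almost everywhere; continuity of
f does the rest. -/
theorem IsInverseLaplace.eq_zero_of_mem_NG {y : StrongDual ℝ V} (hy : y ∈ δ) {φ : ratRing Δ}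
    (hφ : φ ∈ posFracSpan Δ y) (hφ' : φ ∈ NG Δ) {f : reg Δ → ℝ}
    (hf : IsInverseLaplace μ Δ δ φ f) : f = 0 := by
  obtain ⟨A, hA, hA0⟩ := exists_derivMonoid_eq_zero_of_mem_NG hφ'
  obtain ⟨q, hq, h⟩ := exists_isInverseLaplace_derivMonoid (μ := μ) hδ hy hA
  have h1 := (h φ hφ f hf).2
  rw [hA0] at h1
  have h2 := h1.unique hδ IsInverseLaplace.zero
  refine eq_zero_of_mem_locPoly_of_ae μ hf.1 (F := extendZero f) (extendZero_apply f) ?_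
  filter_upwards [hq] with x hx
  by_cases hxr : x ∈ reg Δ
  · rw [extendZero_apply f ⟨x, hxr⟩]
    exact (mul_eq_zero.1 (congrFun h2 ⟨x, hxr⟩)).resolve_left hx
  · simp [extendZero, Function.extend_apply', hxr]

/-! ### The stratified Fourier transform -/

variable (μ Δ δ) in
/-- `g` is the limit along `p` of the inverse Laplace transform of the component of `φ` in `G_Δ`,
with respect to some decomposition of `φ` in `G_Δ + NG_Δ`. -/
def IsStratifiedValue (p : V) (φ : ratRing Δ) (g : V → ℝ) : Prop :=
  ∃ φ₁ ∈ G Δ, ∃ φ₂ ∈ NG Δ, φ = φ₁ + φ₂ ∧ ∃ f, IsInverseLaplace μ Δ δ φ₁ f ∧ IsLimitAlong p f g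

theorem IsStratifiedValue.add {p : V} {φ ψ : ratRing Δ} {g k : V → ℝ}
    (h : IsStratifiedValue μ Δ δ p φ g) (h' : IsStratifiedValue μ Δ δ p ψ k) :
    IsStratifiedValue μ Δ δ p (φ + ψ) (g + k) := by
  obtain ⟨φ₁, h₁, φ₂, h₂, rfl, f, hf, hg⟩ := h
  obtain ⟨ψ₁, h₁', ψ₂, h₂', rfl, f', hf', hk⟩ := h'
  exact ⟨φ₁ + ψ₁, add_mem h₁ h₁', φ₂ + ψ₂, add_mem h₂ h₂', by abel, f + f', hf.add hδ hf',
    hg.add hk⟩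

omit [BorelSpace V] [μ.IsAddHaarMeasure] hδ in
theorem IsStratifiedValue.smul {p : V} (hp : p ∈ reg Δ) {φ : ratRing Δ} {g : V → ℝ} (c : ℝ)
    (h : IsStratifiedValue μ Δ δ p φ g) : IsStratifiedValue μ Δ δ p (c • φ) (c • g) := by
  obtain ⟨φ₁, h₁, φ₂, h₂, rfl, f, hf, hg⟩ := h
  exact ⟨c • φ₁, Submodule.smul_mem _ c h₁, c • φ₂, Submodule.smul_mem _ c h₂, smul_add _ _ _,
    c • f, hf.smul c, hg.smul hp c⟩

/-- The G_Δ-components of two decompositions differ by an element of G_Δ ∩ NG_Δ, whose inverse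
Laplace transform is zero. -/
theorem IsStratifiedValue.unique (hneg : ∀ α ∈ Δ, -α ∈ Δ) {p : V} {φ : ratRing Δ} {g k : V → ℝ}
    (h : IsStratifiedValue μ Δ δ p φ g) (h' : IsStratifiedValue μ Δ δ p φ k) : g = k := by
  obtain ⟨φ₁, h₁, φ₂, h₂, rfl, f, hf, hg⟩ := h
  obtain ⟨ψ₁, h₁', ψ₂, h₂', heq, f', hf', hk⟩ := h'
  obtain ⟨y, hy⟩ := hδ.nonempty
  have hfd := hf.add hδ (hf'.smul (-1))
  have hG : φ₁ + (-1 : ℝ) • ψ₁ ∈ posFracSpan Δ y := by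
    rw [← G_eq_posFracSpan hneg (hδ.subset_dualReg hy)]
    exact add_mem h₁ (Submodule.smul_mem _ _ h₁')
  have hNG : φ₁ + (-1 : ℝ) • ψ₁ ∈ NG Δ := by
    have : φ₁ + (-1 : ℝ) • ψ₁ = ψ₂ - φ₂ := by
      rw [neg_one_smul, ← sub_eq_add_neg, sub_eq_sub_iff_add_eq_add, heq, add_comm]
    rw [this]
    exact sub_mem h₂' h₂
  have h0 := hfd.eq_zero_of_mem_NG hδ hy hG hNG
  rw [neg_one_smul, ← sub_eq_add_neg, sub_eq_zero] at h0
  subst h0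
  exact hg.unique hk

theorem IsStratifiedValue.dirDerivation (hneg : ∀ α ∈ Δ, -α ∈ Δ) {p : V} (hp : p ∈ reg Δ)
    {φ : ratRing Δ} {g : V → ℝ} (h : IsStratifiedValue μ Δ δ p φ g) (w : StrongDual ℝ V) :
    IsStratifiedValue μ Δ δ p (StratifiedFourier.dirDerivation Δ w φ) fun x => -(w x) * g x := by
  obtain ⟨φ₁, h₁, φ₂, h₂, rfl, f, hf, hg⟩ := h
  obtain ⟨y, hy⟩ := hδ.nonempty
  have hG := G_eq_posFracSpan hneg (hδ.subset_dualReg hy)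
  rw [hG] at h₁
  refine ⟨_, hG ▸ dirDerivation_mem_posFracSpan w h₁, _, dirDerivation_mem_NG w h₂, map_add _ _ _,
    _, hf.dirDerivation hδ hy h₁ w, ?_⟩
  exact hg.continuous_mul hp (q := fun x => -(w x)) (by fun_prop)

theorem exists_isStratifiedValue (hneg : ∀ α ∈ Δ, -α ∈ Δ) {γ : Set V} (hγ : IsChamber Δ γ) {p : V}
    (hp : p ∈ γ) (φ : ratRing Δ) : ∃ g : piecePoly Δ, IsStratifiedValue μ Δ δ p φ g.1 := by
  have h : φ ∈ G Δ ⊔ NG Δ := by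
    rw [G_sup_NG]
    trivial
  obtain ⟨φ₁, h₁, φ₂, h₂, rfl⟩ := Submodule.mem_sup.1 h
  obtain ⟨f, hf, -⟩ := existsUnique_isInverseLaplace μ hδ hneg h₁
  obtain ⟨g, hg, hlim⟩ := exists_isLimitAlong hγ hp hf.1
  exact ⟨⟨g, hg⟩, φ₁, h₁, φ₂, h₂, rfl, f, hf, hlim⟩

theorem exists_linearMap_isStratifiedValue (hneg : ∀ α ∈ Δ, -α ∈ Δ) {γ : Set V}
    (hγ : IsChamber Δ γ) {p : V} (hp : p ∈ γ) :
    ∃ F : ratRing Δ →ₗ[ℝ] piecePoly Δ, ∀ φ, IsStratifiedValue μ Δ δ p φ (F φ).1 := by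
  -- Arbitrary choices suffice: uniqueness of the value forces them to be linear in φ.
  choose F hF using exists_isStratifiedValue (μ := μ) hδ hneg hγ hp
  exact ⟨{ toFun := F
           map_add' := fun φ ψ => Subtype.ext
            ((hF (φ + ψ)).unique hδ hneg ((hF φ).add hδ (hF ψ)))
           map_smul' := fun c φ => Subtype.ext
            ((hF (c • φ)).unique hδ hneg ((hF φ).smul (hγ.subset_reg hp) c)) }, hF⟩

theorem IsBasis.isStratifiedValue {σ : Finset V} (hσ : IsBasis Δ σ) (hσδ : cone σ ⊆ dualCone δ)
    {γ : Set V} (hγ : IsChamber Δ γ) {p : V} (hp : p ∈ γ) :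
    IsStratifiedValue μ Δ δ p (vol μ σ • invProd Δ σ hσ.1.1 fun _ => 1)
      ((shiftedCone γ σ).indicator 1) := by
  have h := (hσ.isInverseLaplace_frac μ hδ hσδ 0).smul (vol μ σ)
  refine ⟨_, Submodule.smul_mem _ _ (Submodule.subset_span
    ⟨σ, hσ.1, fun _ => 1, fun _ _ => one_pos, rfl⟩), 0, zero_mem _, (add_zero _).symm, _, h, ?_⟩
  convert hσ.isLimitAlong_indicator hγ hp using 1
  funext x
  have hv := (hσ.map_measure μ).1.ne'
  simp [IsBasis.expPoly, hv]

/-- In each condition both sides are values for the same element of R_Δ, hence equal. -/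
theorem isStratifiedFourier_of_isStratifiedValue (hneg : ∀ α ∈ Δ, -α ∈ Δ) {γ : Set V}
    (hγ : IsChamber Δ γ) {p : V} (hp : p ∈ γ) {F : ratRing Δ →ₗ[ℝ] piecePoly Δ}
    (hF : ∀ φ, IsStratifiedValue μ Δ δ p φ (F φ).1) : IsStratifiedFourier μ Δ γ δ F where
  map_dirDeriv w φ h := congrFun ((hF (dirDeriv Δ w φ)).unique hδ hneg
    ((hF φ).dirDerivation hδ hneg (hγ.subset_reg hp) w)) h
  map_basis σ hσ hσδ := (hF _).unique hδ hneg (hσ.isStratifiedValue hδ hσδ hγ hp)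
  map_NG φ hφ := by
    have h0 : IsStratifiedValue μ Δ δ p φ 0 :=
      ⟨0, zero_mem _, φ, hφ, (zero_add φ).symm, 0, IsInverseLaplace.zero, IsLimitAlong.zero p⟩
    exact Subtype.ext ((hF φ).unique hδ hneg h0)

omit hδ in
-- The derivative along the dual basis vector of a raises the exponent at a by one, up to a nonzero
-- factor. So the values at all basis fractions follow from the value at 1/∏ a, which `map_basis`
-- prescribes.
theorem IsStratifiedFourier.map_frac_eq {γ : Set V} {F F' : ratRing Δ →ₗ[ℝ] piecePoly Δ}
    (hF : IsStratifiedFourier μ Δ γ δ F) (hF' : IsStratifiedFourier μ Δ γ δ F') {σ : Finset V}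
    (hσ : IsBasis Δ σ) (hσδ : cone σ ⊆ dualCone δ) :
    ∀ (k : ℕ) (m : V → ℕ), ∑ a ∈ σ, m a = k → F (hσ.frac m) = F' (hσ.frac m) := by
  classical
  intro k
  induction k with
  | zero =>
    intro m hm
    have e : hσ.frac m = invProd Δ σ hσ.1.1 fun _ => 1 :=
      invProd_congr _ fun a ha => by rw [Finset.sum_eq_zero_iff.1 hm a ha]
    have h : F (vol μ σ • hσ.frac m) = F' (vol μ σ • hσ.frac m) := by
      rw [e]
      exact Subtype.ext ((hF.map_basis σ hσ hσδ).trans (hF'.map_basis σ hσ hσδ).symm)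
    rw [map_smul, map_smul] at h
    exact smul_right_injective _ (hσ.map_measure μ).1.ne' h
  | succ k ih =>
    intro m hm
    obtain ⟨a, ha, hma⟩ : ∃ a ∈ σ, 0 < m a := by
      by_contra hcon
      push Not at hcon
      have := Finset.sum_eq_zero fun a ha => Nat.le_zero.1 (hcon a ha)
      omega
    obtain ⟨m, rfl⟩ := exists_bump hma
    rw [sum_bump ha] at hm
    have h1 : dirDeriv Δ (hσ.coord ⟨a, ha⟩) (hσ.frac m) =
        (-((m a : ℝ) + 1)) • hσ.frac (bump m a) := by
      rw [← dirDerivation_apply, hσ.dirDerivation_frac, Finset.sum_eq_single a]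
      · rw [hσ.coord_self ⟨a, ha⟩ ⟨a, ha⟩]
        simp
      · intro b hb hba
        rw [hσ.coord_self ⟨a, ha⟩ ⟨b, hb⟩, if_neg fun h => hba (congrArg Subtype.val h).symm]
        simp
      · exact fun h => absurd ha h
    have h2 : F (dirDeriv Δ (hσ.coord ⟨a, ha⟩) (hσ.frac m)) =
        F' (dirDeriv Δ (hσ.coord ⟨a, ha⟩) (hσ.frac m)) :=
      Subtype.ext (funext fun h => by
        rw [hF.map_dirDeriv, hF'.map_dirDeriv, ih m (by omega)])
    rw [h1, map_smul, map_smul] at h2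
    have h3 : (-((m a : ℝ) + 1)) ≠ 0 := neg_ne_zero.2 (by positivity)
    exact smul_right_injective _ h3 h2

theorem IsStratifiedFourier.unique (hneg : ∀ α ∈ Δ, -α ∈ Δ) {γ : Set V}
    {F F' : ratRing Δ →ₗ[ℝ] piecePoly Δ}
    (hF : IsStratifiedFourier μ Δ γ δ F) (hF' : IsStratifiedFourier μ Δ γ δ F') : F = F' := by
  obtain ⟨y, hy⟩ := hδ.nonempty
  refine LinearMap.ext fun φ => ?_
  have h : φ ∈ G Δ ⊔ NG Δ := by
    rw [G_sup_NG]
    trivial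
  obtain ⟨φ₁, h₁, φ₂, h₂, rfl⟩ := Submodule.mem_sup.1 h
  rw [map_add, map_add, hF.map_NG φ₂ h₂, hF'.map_NG φ₂ h₂]
  congr 1
  rw [G_eq_posFracSpan hneg (hδ.subset_dualReg hy)] at h₁
  refine LinearMap.eqOn_span ?_ h₁
  rintro φ ⟨σ, hσ, hσy, m, rfl⟩
  exact hF.map_frac_eq hF' hσ ((hδ.cone_subset_iff hy hσ.1.1).2 hσy) _ m rfl

end Fourier

end StratifiedFourier

end

theorem mainTheorem12 {V : Type*} [NormedAddCommGroup V] [NormedSpace ℝ V]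
    [FiniteDimensional ℝ V] [MeasurableSpace V] [BorelSpace V]
    (μ : Measure V) [μ.IsAddHaarMeasure]
    (Δ : Finset V) (hΔ0 : (0 : V) ∉ Δ) (hΔspan : Submodule.span ℝ (Δ : Set V) = ⊤)
    (hΔneg : ∀ α ∈ Δ, -α ∈ Δ)
    (γ : Set V) (hγ : StratifiedFourier.IsChamber Δ γ) (p : V) (hp : p ∈ γ)
    (δ : Set (StrongDual ℝ V)) (hδ : StratifiedFourier.IsDualChamber Δ δ) :
    -- the objects `F_{γ,δ}` and `F_δ(φ)` are well defined
    (∃! F : StratifiedFourier.ratRing Δ →ₗ[ℝ] StratifiedFourier.piecePoly Δ,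
      StratifiedFourier.IsStratifiedFourier μ Δ γ δ F) ∧
    (∀ φ ∈ StratifiedFourier.G Δ, ∃! f : StratifiedFourier.reg Δ → ℝ,
      StratifiedFourier.IsInverseLaplace μ Δ δ φ f) ∧
    ∀ φ ∈ StratifiedFourier.G Δ,
      -- `h + ε p` is regular for small `ε > 0`, and the limit formula holds
      (∀ h : V, (∀ᶠ ε : ℝ in 𝓝[>] 0, h + ε • p ∈ StratifiedFourier.reg Δ) ∧
        Tendsto (fun ε : ℝ => StratifiedFourier.extendZero
            (StratifiedFourier.inverseLaplace μ Δ δ φ) (h + ε • p)) (𝓝[>] 0)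
          (𝓝 ((StratifiedFourier.stratifiedFourier μ Δ γ δ φ).1 h))) ∧
      -- `F_{γ,δ}(φ)` extends `F_δ(φ)`
      (∀ h : StratifiedFourier.reg Δ, (StratifiedFourier.stratifiedFourier μ Δ γ δ φ).1 h.1 =
        StratifiedFourier.inverseLaplace μ Δ δ φ h) ∧
      -- and it is the continuous extension whenever there is one
      (∀ g : V → ℝ, Continuous g →
        (∀ h : StratifiedFourier.reg Δ, g h.1 = StratifiedFourier.inverseLaplace μ Δ δ φ h) →
        g = (StratifiedFourier.stratifiedFourier μ Δ γ δ φ).1) := by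
  have hpr : p ∈ StratifiedFourier.reg Δ := hγ.subset_reg hp
  obtain ⟨F, hF⟩ := StratifiedFourier.exists_linearMap_isStratifiedValue (μ := μ) hδ hΔneg hγ hp
  have hF' := StratifiedFourier.isStratifiedFourier_of_isStratifiedValue hδ hΔneg hγ hp hF
  -- The map is defined by an arbitrary choice; existence and uniqueness identify it with the F
  -- constructed from limits.
  have hSF : StratifiedFourier.stratifiedFourier μ Δ γ δ = F :=
    StratifiedFourier.IsStratifiedFourier.unique hδ hΔneg
      (Classical.epsilon_spec (p := StratifiedFourier.IsStratifiedFourier μ Δ γ δ) ⟨F, hF'⟩) hF'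
  refine ⟨⟨F, hF', fun F₁ h₁ => StratifiedFourier.IsStratifiedFourier.unique hδ hΔneg h₁ hF'⟩,
    fun φ hφ => StratifiedFourier.existsUnique_isInverseLaplace μ hδ hΔneg hφ, fun φ hφ => ?_⟩
  have hL := StratifiedFourier.isInverseLaplace_inverseLaplace μ hδ hΔneg hφ
  have hlim : StratifiedFourier.IsLimitAlong p (StratifiedFourier.inverseLaplace μ Δ δ φ)
      (StratifiedFourier.stratifiedFourier μ Δ γ δ φ).1 := by
    obtain ⟨g, -, hg⟩ := StratifiedFourier.exists_isLimitAlong hγ hp hL.1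
    -- For φ ∈ G_Δ the decomposition φ + 0 may be used, so the value is the limit of F_δ(φ) itself.
    rw [hSF, (hF φ).unique hδ hΔneg ⟨φ, hφ, 0, zero_mem _, (add_zero φ).symm, _, hL, hg⟩]
    exact hg
  exact ⟨fun h => ⟨StratifiedFourier.eventually_add_smul_mem_reg Δ hpr h, hlim h⟩,
    hlim.eq_of_continuous (StratifiedFourier.continuous_of_mem_locPoly hL.1),
    fun g hg hgL => (StratifiedFourier.isLimitAlong_of_continuous hpr hg hgL).unique hlim⟩
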